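/- **Definitions.** Manifolds are smooth, finite-dimensional, Hausdorff and second countable; Lie groups and Lie algebras are real. Two torsion-free affine connections $\nabla,\nabla'$ on a manifold $M$ are *projectively equivalent*, $\nabla\sim\nabla'$, if there is a smooth 1-form $\phi$ on $M$ with $\nabla_XY-\nabla'_XY=\phi(X)Y+\phi(Y)X$ for all smooth vector fields $X,Y$. Let $\nabla_0$ be the standard flat connection on $\mathbb R^n$. A *left invariant flat projective structure (IFPS)* on an $n$-dimensional Lie group $L$ is the projective equivalence class $[\nabla]$ of a torsion-free affine connection $\nabla$ on $L$ such that (i) each point of $L$ has an open neighbourhood $U$ and a diffeomorphism $f$ from $U$ onto an open subset of $\mathbb R^n$ with $f^*\nabla_0\sim\nabla$ on $U$; (ii) $L_g^*\nabla\sim\nabla$ for every left translation $L_g$, $g\in L$. A Lie algebra $\mathfrak l$ *admits an IFPS* if it is isomorphic to the Lie algebra of a Lie group that admits an IFPS. **Proposition 3.4.** Let $\mathfrak l_1$ and $\mathfrak l_2$ be Lie algebras each of which admits an IFPS, and let $\mathfrak a_1$ be the one-dimensional abelian Lie algebra. Then $\mathfrak l_1\oplus\mathfrak l_2\oplus\mathfrak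 a_1$ admits an IFPS. -/

import Mathlib

open Bundle Set VectorField
open scoped Manifold ContDiff

noncomputable section

namespace ProjectiveStructure

section Connections

variable {E : Type*} [NormedAddCommGroup E] [NormedSpace ℝ E]
  {M : Type*} [TopologicalSpace M] [ChartedSpace E M]
  {N : Type*} [TopologicalSpace N] [ChartedSpace E N]

/-- Operators of the kind of an affine connection on a manifold `M` modelled on `E`, with the
argument order of Mathlib's `CovariantDerivative`: the vector `D Y x (X x)` is `(D_X Y)(x)`.
This is only the type of such operators; the laws of a connection are imposed where it is used,
through `CovariantDerivative`. -/
abbrev ConnOp (E : Type*) [NormedAddCommGroup E] [NormedSpace ℝ E]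
    (M : Type*) [TopologicalSpace M] [ChartedSpace E M] : Type _ :=
  (Π x : M, TangentSpace 𝓘(ℝ, E) x) →
    (Π x : M, TangentSpace 𝓘(ℝ, E) x →L[ℝ] TangentSpace 𝓘(ℝ, E) x)

/-- The standard affine connection `∇₀` of the vector space `E`: `(∇₀)_X Y` is the derivative of the
map `Y : E → E` along `X`. Equivalently, constant vector fields are parallel. -/
def stdConn (E : Type*) [NormedAddCommGroup E] [NormedSpace ℝ E] : ConnOp E E :=
  fun Y x ↦ fderiv ℝ (F := E) Y x

/-- The pullback `f^*D` of a connection `D` on `N` by a (local) diffeomorphism `f : M → N` with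
(local) inverse `g : N → M`:
`((f^*D)_X Y)(x) = (df_x)⁻¹ ((D_{f_* X} (f_* Y)) (f x))`, where the push-forward `f_* Y` is the
pullback of the vector field `Y` by `g`. -/
def pullbackConn (f : M → N) (g : N → M) (D : ConnOp E N) : ConnOp E M :=
  fun Y x ↦
    (mfderiv 𝓘(ℝ, E) 𝓘(ℝ, E) f x).inverse ∘L
      (D (mpullback 𝓘(ℝ, E) 𝓘(ℝ, E) g Y) (f x)) ∘L
        (mfderiv 𝓘(ℝ, E) 𝓘(ℝ, E) f x)

/-- Smoothness on a set `U` of a 1-form on `M`, as a section of the cotangent bundle. -/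
def SmoothOneFormOn [IsManifold 𝓘(ℝ, E) ∞ M]
    (φ : Π x : M, TangentSpace 𝓘(ℝ, E) x →L[ℝ] ℝ) (U : Set M) : Prop :=
  ContMDiffOn 𝓘(ℝ, E) (𝓘(ℝ, E).prod 𝓘(ℝ, E →L[ℝ] ℝ)) ∞
    (fun x ↦ (⟨x, φ x⟩ : TotalSpace (E →L[ℝ] ℝ)
      (fun x : M ↦ TangentSpace 𝓘(ℝ, E) x →L[ℝ] ℝ))) U

/-- Two connections are projectively equivalent on (the open set) `U` if there is a smooth 1-form
`φ` on `U` with `D_X Y - D'_X Y = φ(X) Y + φ(Y) X` on `U`, for all smooth vector fields `X`, `Y`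
on `U`. -/
def ProjEquivOn [IsManifold 𝓘(ℝ, E) ∞ M] (U : Set M) (D D' : ConnOp E M) : Prop :=
  ∃ φ : Π x : M, TangentSpace 𝓘(ℝ, E) x →L[ℝ] ℝ, SmoothOneFormOn φ U ∧
    ∀ X Y : Π x : M, TangentSpace 𝓘(ℝ, E) x,
      ContMDiffOn 𝓘(ℝ, E) 𝓘(ℝ, E).tangent ∞ (fun x ↦ (⟨x, X x⟩ : TangentBundle 𝓘(ℝ, E) M)) U →
      ContMDiffOn 𝓘(ℝ, E) 𝓘(ℝ, E).tangent ∞ (fun x ↦ (⟨x, Y x⟩ : TangentBundle 𝓘(ℝ, E) M)) U →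
      ∀ x ∈ U, D Y x (X x) - D' Y x (X x) = φ x (X x) • Y x + φ x (Y x) • X x

end Connections

section LieGroups

variable {E : Type*} [NormedAddCommGroup E] [NormedSpace ℝ E] [FiniteDimensional ℝ E]
  {L : Type*} [TopologicalSpace L] [ChartedSpace E L] [Group L] [LieGroup 𝓘(ℝ, E) ∞ L]

/-- `D` is a smooth torsion-free affine connection on the Lie group `L` whose projective class
`[D]` is a left invariant flat projective structure (IFPS) on `L`. -/
structure IsIFPS (D : CovariantDerivative 𝓘(ℝ, E) E (TangentSpace 𝓘(ℝ, E) : L → Type _)) :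
    Prop where
  smooth : D.ContMDiffCovariantDerivative ∞
  torsion_eq_zero : D.torsion = 0
  /-- Flatness: around each point there is a diffeomorphism `f` from an open neighbourhood onto an
  open subset of `E` with `f^*∇₀ ∼ D` on that neighbourhood. -/
  flat : ∀ p : L, ∃ f : OpenPartialHomeomorph L E, p ∈ f.source ∧
    ContMDiffOn 𝓘(ℝ, E) 𝓘(ℝ, E) ∞ f f.source ∧
    ContMDiffOn 𝓘(ℝ, E) 𝓘(ℝ, E) ∞ f.symm f.target ∧
    ProjEquivOn f.source (pullbackConn f f.symm (stdConn E)) D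
  /-- Left invariance: `L_a^*D ∼ D` for every left translation `L_a`. -/
  left_invariant : ∀ a : L,
    ProjEquivOn univ (pullbackConn (fun x : L ↦ a * x) (fun x : L ↦ a⁻¹ * x) D) D

variable (E L) in
/-- The Lie group `L` admits an IFPS. -/
def LieGroupAdmitsIFPS : Prop :=
  ∃ D : CovariantDerivative 𝓘(ℝ, E) E (TangentSpace 𝓘(ℝ, E) : L → Type _), IsIFPS D

/-- A smooth real Lie group has the smoothness that Mathlib asks for in the construction of the
Lie algebra of a Lie group. -/
instance instLieGroupMinSmoothness : LieGroup 𝓘(ℝ, E) (minSmoothness ℝ 3) L := by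
  rw [minSmoothness_of_isRCLikeNormedField]
  infer_instance

end LieGroups

/-- A real Lie algebra `𝔩` admits an IFPS if it is (isomorphic to) the Lie algebra of a
finite-dimensional real Lie group that admits an IFPS. Manifolds are Hausdorff and second
countable. -/
def AdmitsIFPS (𝔩 : Type*) [LieRing 𝔩] [LieAlgebra ℝ 𝔩] : Prop :=
  ∃ (E : Type) (_ : NormedAddCommGroup E) (_ : NormedSpace ℝ E) (_ : FiniteDimensional ℝ E)
    (L : Type) (_ : TopologicalSpace L) (_ : T2Space L) (_ : SecondCountableTopology L)
    (_ : ChartedSpace E L) (_ : Group L) (_ : LieGroup 𝓘(ℝ, E) ∞ L),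
    Nonempty (𝔩 ≃ₗ⁅ℝ⁆ GroupLieAlgebra 𝓘(ℝ, E) L) ∧ LieGroupAdmitsIFPS E L

end ProjectiveStructure

end

/-!
The idea is to replace a left-invariant flat projective structure on an `n`-dimensional Lie group
by a *homogeneous lift* (`IsHomogeneousLift`): a map `F` from a neighbourhood of the identity to a
vector space of dimension `n + 1` which, together with its first derivatives, spans this space at
the identity, and which satisfies a linear system `∂_ξ ∂_η F = ∂_ζ F + c F` with constant
coefficients, `∂_ξ` being the derivative along the left-invariant vector field of `ξ`. It is a
developing map of the projective structure, lifted from projective space to its vector space.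

* A left-invariant flat projective structure has a homogeneous lift if `n ≥ 2`
  (`LieGroupAdmitsIFPS.hasHomogeneousLift`). Flatness and left invariance together say that a flat
  chart `f` satisfies `∂_ξ ∂_η f = ∂_{Γ(ξ,η)} f + θ(ξ) ∂_η f + θ(η) ∂_ξ f` with `Γ` constant. The
  one-form `θ` is, up to a constant form, the logarithmic derivative of a power of the Jacobian
  determinant of `f` (`exists_leftD_eq_neg_mul`), so for a suitable factor `l` the map `l (f, 1)`
  satisfies a system of the required kind, except that `c` may depend on the point. Comparing the
  two orders of differentiation in a third derivative shows that `c` is constant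
  (`leftD_coefficient_const`).
* If `F₁` and `F₂` are homogeneous lifts on `L₁` and `L₂`, then `(t F₁, F₂)` is one on
  `L₁ × L₂ × ℝˣ` (`IsHomogeneousLift.prod`). This explains the additional one-dimensional factor:
  the dimensions of the vector spaces add up, so the group has to gain a dimension, and its
  direction absorbs the difference of the coefficients `c` of the two systems.
* Conversely a homogeneous lift `F = (u, l)` gives a left-invariant flat projective structure
  (`IsHomogeneousLift.lieGroupAdmitsIFPS`): the system determines a bilinear map `b` on the Lie
  algebra, hence a left-invariant connection `invariantConn`. The antisymmetric part of `b` is the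
  Lie bracket because derivatives commute up to the bracket, so there is no torsion, and `u / l` is
  a flat chart at the identity. Its left translates are flat charts elsewhere.

In dimension one the first step fails, as `c` need not be constant; but there the Lie algebra is
that of `ℝˣ`, on which `(t, 1)` is a homogeneous lift. In dimension zero a constant will do.
-/

noncomputable section

namespace ProjectiveStructure

open Filter Topology

/-! ### Derivatives of vector-valued functions on manifolds -/

section Calculus

variable {E : Type*} [NormedAddCommGroup E] [NormedSpace ℝ E]
  {M : Type*} [TopologicalSpace M] [ChartedSpace E M]
  {E' : Type*} [NormedAddCommGroup E'] [NormedSpace ℝ E']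
  {N : Type*} [TopologicalSpace N] [ChartedSpace E' N]
  {V : Type*} [NormedAddCommGroup V] [NormedSpace ℝ V]
  {W : Type*} [NormedAddCommGroup W] [NormedSpace ℝ W]

theorem mvfderiv_comp_vector {f : M → N} {u : N → V} (x : M)
    (hu : MDifferentiableAt 𝓘(ℝ, E') 𝓘(ℝ, V) u (f x))
    (hf : MDifferentiableAt 𝓘(ℝ, E) 𝓘(ℝ, E') f x) (v : TangentSpace 𝓘(ℝ, E) x) :
    mvfderiv 𝓘(ℝ, E) (u ∘ f) x v =
      mvfderiv 𝓘(ℝ, E') u (f x) (mfderiv 𝓘(ℝ, E) 𝓘(ℝ, E') f x v) :=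
  mfderiv_comp_apply x hu hf v

theorem mvfderiv_eq_fderiv {u : E → V} (x : E) (v : TangentSpace 𝓘(ℝ, E) x) :
    mvfderiv 𝓘(ℝ, E) u x v = fderiv ℝ u x v := by
  have := mfderiv_eq_fderiv (𝕜 := ℝ) (f := u) (x := x)
  exact congrArg (fun A : E →L[ℝ] V ↦ A v) this

theorem mvfderiv_congr {u u' : M → V} {x : M} (h : u =ᶠ[𝓝 x] u') :
    mvfderiv 𝓘(ℝ, E) u x = mvfderiv 𝓘(ℝ, E) u' x := by
  ext v
  have := h.mfderiv_eq (I := 𝓘(ℝ, E)) (I' := 𝓘(ℝ, V))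
  exact congrArg (fun A : E →L[ℝ] V ↦ A v) this

theorem mvfderiv_clm_comp (A : V →L[ℝ] W) {u : M → V} {x : M}
    (hu : MDifferentiableAt 𝓘(ℝ, E) 𝓘(ℝ, V) u x) (v : TangentSpace 𝓘(ℝ, E) x) :
    mvfderiv 𝓘(ℝ, E) (fun y ↦ A (u y)) x v = A (mvfderiv 𝓘(ℝ, E) u x v) := by
  have h := mvfderiv_comp_vector (u := A) (f := u) x A.differentiableAt.mdifferentiableAt hu v
  rw [mvfderiv_eq_fderiv, A.fderiv] at h
  exact h

/-- The derivative of a smooth vector-valued function along a smooth vector field is smooth. -/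
theorem contMDiffOn_mvfderiv_apply [IsManifold 𝓘(ℝ, E) ∞ M] {u : M → V} {U : Set M}
    (hU : IsOpen U) (hu : ContMDiffOn 𝓘(ℝ, E) 𝓘(ℝ, V) ∞ u U)
    {X : Π x : M, TangentSpace 𝓘(ℝ, E) x}
    (hX : ContMDiffOn 𝓘(ℝ, E) 𝓘(ℝ, E).tangent ∞
      (fun x ↦ (⟨x, X x⟩ : TangentBundle 𝓘(ℝ, E) M)) U) :
    ContMDiffOn 𝓘(ℝ, E) 𝓘(ℝ, V) ∞ (fun x ↦ mvfderiv 𝓘(ℝ, E) u x (X x)) U := by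
  have h1 := hu.contMDiffOn_tangentMapWithin (m := ∞) le_rfl hU.uniqueMDiffOn
  have h2 := h1.comp hX (fun x hx ↦ hx)
  have h3 := (contMDiff_snd_tangentBundle_modelSpace (n := ∞) V 𝓘(ℝ, V)).comp_contMDiffOn h2
  refine h3.congr fun x hx ↦ ?_
  simp only [Function.comp, tangentMapWithin, mfderivWithin_of_isOpen hU hx]
  rfl

/-- In a vector space, the Lie bracket of vector fields acts on functions as the commutator of
derivations, by the symmetry of the second derivative. -/
theorem fderiv_lieBracket {X Y : E → E} {u : E → V} {p : E}
    (hX : DifferentiableAt ℝ X p) (hY : DifferentiableAt ℝ Y p) (hu : ContDiffAt ℝ ∞ u p) :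
    fderiv ℝ (fun z ↦ fderiv ℝ u z (Y z)) p (X p) -
      fderiv ℝ (fun z ↦ fderiv ℝ u z (X z)) p (Y p) = fderiv ℝ u p (lieBracket ℝ X Y p) := by
  have hd : DifferentiableAt ℝ (fderiv ℝ u) p :=
    (hu.fderiv_right (m := 1) (by norm_num; exact ENat.LEInfty.out)).differentiableAt (by simp)
  have hs : IsSymmSndFDerivAt ℝ u p :=
    hu.isSymmSndFDerivAt (by
      rw [minSmoothness_of_isRCLikeNormedField]; exact ENat.LEInfty.out)
  have e : ∀ Z : E → E, DifferentiableAt ℝ Z p → ∀ w : E,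
      fderiv ℝ (fun z ↦ fderiv ℝ u z (Z z)) p w =
        fderiv ℝ (fderiv ℝ u) p w (Z p) + fderiv ℝ u p (fderiv ℝ Z p w) := by
    intro Z hZ w
    rw [fderiv_clm_apply hd hZ]
    simp [add_comm]
  rw [e Y hY, e X hX, lieBracket, hs.eq (X p) (Y p), map_sub]
  abel

theorem mlieBracket_eq_lieBracket (X Y : E → E) (z : E) :
    mlieBracket 𝓘(ℝ, E) (X : Π z : E, TangentSpace 𝓘(ℝ, E) z) Y z = lieBracket ℝ X Y z := by
  have h := congrFun (mlieBracketWithin_eq_lieBracketWithin (𝕜 := ℝ) (V := X) (W := Y)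
    (s := univ)) z
  rw [lieBracketWithin_univ] at h
  exact h

/-- Pulling back a vector field by the inverse of a chart is pushing it forward by the chart. -/
theorem mpullback_symm_apply {φ : OpenPartialHomeomorph M E}
    (hφ : φ.MDifferentiable 𝓘(ℝ, E) 𝓘(ℝ, E)) (X : Π x : M, TangentSpace 𝓘(ℝ, E) x)
    {z : E} (hz : z ∈ φ.target) :
    mpullback 𝓘(ℝ, E) 𝓘(ℝ, E) φ.symm X z =
      mfderiv 𝓘(ℝ, E) 𝓘(ℝ, E) φ (φ.symm z) (X (φ.symm z)) := by
  have h1 : (mfderiv 𝓘(ℝ, E) 𝓘(ℝ, E) φ (φ.symm z)).comp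
      (mfderiv 𝓘(ℝ, E) 𝓘(ℝ, E) φ.symm z : E →L[ℝ] E) = ContinuousLinearMap.id ℝ E :=
    hφ.comp_symm_deriv hz
  have e : ∀ w, w = z → (mfderiv 𝓘(ℝ, E) 𝓘(ℝ, E) φ.symm w : E →L[ℝ] E) =
      mfderiv 𝓘(ℝ, E) 𝓘(ℝ, E) φ.symm z := by rintro _ rfl; rfl
  have h2 : (mfderiv 𝓘(ℝ, E) 𝓘(ℝ, E) φ.symm z : E →L[ℝ] E).comp
      (mfderiv 𝓘(ℝ, E) 𝓘(ℝ, E) φ (φ.symm z) : E →L[ℝ] E) = ContinuousLinearMap.id ℝ E := by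
    rw [← e _ (φ.right_inv hz)]
    exact hφ.symm_comp_deriv (φ.map_target hz)
  have h3 : (mfderiv 𝓘(ℝ, E) 𝓘(ℝ, E) φ.symm z : E →L[ℝ] E).inverse =
      mfderiv 𝓘(ℝ, E) 𝓘(ℝ, E) φ (φ.symm z) := ContinuousLinearMap.inverse_eq h2 h1
  exact congrArg (fun A : E →L[ℝ] E ↦ A (X (φ.symm z))) h3

end Calculus

section Commutator

variable {E : Type*} [NormedAddCommGroup E] [NormedSpace ℝ E] [CompleteSpace E]
  {M : Type*} [TopologicalSpace M] [ChartedSpace E M] [IsManifold 𝓘(ℝ, E) ∞ M]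
  {V : Type*} [NormedAddCommGroup V] [NormedSpace ℝ V]

/-- The Lie bracket of vector fields acts on functions as the commutator of derivations. -/
theorem mvfderiv_mlieBracket {u : M → V} {p : M}
    (hu : ContMDiffAt 𝓘(ℝ, E) 𝓘(ℝ, V) ∞ u p)
    {X Y : Π x : M, TangentSpace 𝓘(ℝ, E) x}
    (hX : MDifferentiableAt 𝓘(ℝ, E) 𝓘(ℝ, E).tangent
      (fun x ↦ (⟨x, X x⟩ : TangentBundle 𝓘(ℝ, E) M)) p)
    (hY : MDifferentiableAt 𝓘(ℝ, E) 𝓘(ℝ, E).tangent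
      (fun x ↦ (⟨x, Y x⟩ : TangentBundle 𝓘(ℝ, E) M)) p) :
    mvfderiv 𝓘(ℝ, E) (fun x ↦ mvfderiv 𝓘(ℝ, E) u x (Y x)) p (X p) -
      mvfderiv 𝓘(ℝ, E) (fun x ↦ mvfderiv 𝓘(ℝ, E) u x (X x)) p (Y p) =
        mvfderiv 𝓘(ℝ, E) u p (mlieBracket 𝓘(ℝ, E) X Y p) := by
  obtain ⟨φ, hφ, hps, hsm, hbr⟩ : ∃ φ : OpenPartialHomeomorph M E,
      φ.MDifferentiable 𝓘(ℝ, E) 𝓘(ℝ, E) ∧ p ∈ φ.source ∧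
      ContMDiffAt 𝓘(ℝ, E) 𝓘(ℝ, E) ∞ φ.symm (φ p) ∧
      ∀ z ∈ φ.target, (mfderiv 𝓘(ℝ, E) 𝓘(ℝ, E) φ.symm z).IsInvertible := by
    refine ⟨chartAt E p, mdifferentiable_chart p, mem_chart_source E p, ?_, fun z hz ↦ ?_⟩
    · exact (contMDiffOn_chart_symm (x := p)).contMDiffAt
        ((chartAt E p).open_target.mem_nhds (mem_chart_target E p))
    · exact ⟨(mdifferentiable_chart p).symm.mfderiv hz, rfl⟩
  obtain ⟨z₀, hz₀, hφp, rfl⟩ : ∃ z ∈ φ.target, φ p = z ∧ φ.symm z = p :=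
    ⟨φ p, φ.map_source hps, rfl, φ.left_inv hps⟩
  rw [hφp] at hsm
  let σ := φ.symm
  have hu' : ContDiffAt ℝ ∞ (u ∘ σ) z₀ := (hu.comp z₀ hsm).contDiffAt
  have hud : ∀ᶠ z in 𝓝 z₀, DifferentiableAt ℝ (u ∘ σ) z := by
    have h1 : ContDiffAt ℝ 1 (u ∘ σ) z₀ := hu'.of_le (by exact ENat.LEInfty.out)
    filter_upwards [h1.eventually (by simp)] with x hx using hx.differentiableAt one_ne_zero
  have key : ∀ Z : Π x : M, TangentSpace 𝓘(ℝ, E) x,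
      MDifferentiableAt 𝓘(ℝ, E) 𝓘(ℝ, E).tangent
        (fun x ↦ (⟨x, Z x⟩ : TangentBundle 𝓘(ℝ, E) M)) (σ z₀) →
      ∃ Z' : E → E, Z' = mpullback 𝓘(ℝ, E) 𝓘(ℝ, E) σ Z ∧ DifferentiableAt ℝ Z' z₀ := by
    intro Z hZ
    refine ⟨_, rfl, ?_⟩
    have h := hZ.mpullback_vectorField (n := ∞) hsm (hbr z₀ hz₀) ENat.LEInfty.out
    exact ((contMDiff_snd_tangentBundle_modelSpace (n := 1) E 𝓘(ℝ, E)).mdifferentiable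
      one_ne_zero _).comp z₀ h |>.differentiableAt
  obtain ⟨X', hX', dX'⟩ := key X hX
  obtain ⟨Y', hY', dY'⟩ := key Y hY
  -- derivatives along corresponding vector fields on `M` and on `E` agree
  have push : ∀ (Z : Π x : M, TangentSpace 𝓘(ℝ, E) x) (w : E → V) (z : E), z ∈ φ.target →
      DifferentiableAt ℝ w z → mvfderiv 𝓘(ℝ, E) (w ∘ φ) (σ z) (Z (σ z)) =
        fderiv ℝ w z (mpullback 𝓘(ℝ, E) 𝓘(ℝ, E) σ Z z) := by
    intro Z w z hz hw
    have e : φ (σ z) = z := φ.right_inv hz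
    have hw' : DifferentiableAt ℝ w (φ (σ z)) := by rwa [e]
    rw [mvfderiv_comp_vector (u := w) (f := φ) (σ z) hw'.mdifferentiableAt
      (hφ.mdifferentiableAt (φ.map_target hz)), mvfderiv_eq_fderiv, e,
      mpullback_symm_apply hφ Z hz]
    rfl
  have hσs : σ z₀ ∈ φ.source := φ.map_target hz₀
  have hφu : ∀ x ∈ φ.source, u =ᶠ[𝓝 x] (u ∘ σ) ∘ φ := fun x hx ↦ by
    filter_upwards [φ.open_source.mem_nhds hx] with y hy
    simp [σ, φ.left_inv hy]
  have push' : ∀ (Z : Π x : M, TangentSpace 𝓘(ℝ, E) x) (x : M), x ∈ φ.source →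
      DifferentiableAt ℝ (u ∘ σ) (φ x) → mvfderiv 𝓘(ℝ, E) u x (Z x) =
        fderiv ℝ (u ∘ σ) (φ x) (mpullback 𝓘(ℝ, E) 𝓘(ℝ, E) σ Z (φ x)) := by
    intro Z x hx hd
    rw [← push Z _ _ (φ.map_source hx) hd, mvfderiv_congr (hφu x hx)]
    have : ∀ y, y = x → mvfderiv 𝓘(ℝ, E) ((u ∘ σ) ∘ φ) x (Z x) =
      mvfderiv 𝓘(ℝ, E) ((u ∘ σ) ∘ φ) y (Z y) := by rintro _ rfl; rfl
    exact this _ (φ.left_inv hx)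
  have hev : ∀ Z : Π x : M, TangentSpace 𝓘(ℝ, E) x,
      (fun x ↦ mvfderiv 𝓘(ℝ, E) u x (Z x)) =ᶠ[𝓝 (σ z₀)]
        (fun z ↦ fderiv ℝ (u ∘ σ) z (mpullback 𝓘(ℝ, E) 𝓘(ℝ, E) σ Z z)) ∘ φ := by
    intro Z
    have hc : Tendsto φ (𝓝 (σ z₀)) (𝓝 z₀) := by
      have h : ContinuousAt φ (σ z₀) := φ.continuousAt hσs
      rwa [ContinuousAt, show φ (σ z₀) = z₀ from hφp] at h
    filter_upwards [φ.open_source.mem_nhds hσs, hc.eventually hud] with x hx hd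
    exact push' Z x hx hd
  have hdd : ∀ Z' : E → E, DifferentiableAt ℝ Z' z₀ →
      DifferentiableAt ℝ (fun z ↦ fderiv ℝ (u ∘ σ) z (Z' z)) z₀ := fun Z' h ↦
    ((hu'.fderiv_right (m := 1) (by norm_num; exact ENat.LEInfty.out)).differentiableAt
      one_ne_zero).clm_apply h
  have hL : mvfderiv 𝓘(ℝ, E) u (σ z₀) (mlieBracket 𝓘(ℝ, E) X Y (σ z₀)) =
      fderiv ℝ (u ∘ σ) z₀ (lieBracket ℝ X' Y' z₀) := by
    have hd : DifferentiableAt ℝ (u ∘ σ) (φ (σ z₀)) := by rw [hφp]; exact hud.self_of_nhds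
    have : IsManifold 𝓘(ℝ, E) (minSmoothness ℝ 2) M := by
      rw [minSmoothness_of_isRCLikeNormedField]; infer_instance
    have : IsManifold 𝓘(ℝ, E) (minSmoothness ℝ 3) M := by
      rw [minSmoothness_of_isRCLikeNormedField]; infer_instance
    rw [push' (mlieBracket 𝓘(ℝ, E) X Y) _ hσs hd, hφp,
      mpullback_mlieBracket hX hY hsm (by
        rw [minSmoothness_of_isRCLikeNormedField]; exact ENat.LEInfty.out)]
    subst hX' hY'
    exact congrArg (fun w : E ↦ fderiv ℝ (u ∘ σ) z₀ w) (mlieBracket_eq_lieBracket _ _ _)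
  rw [hL, mvfderiv_congr (hev X), mvfderiv_congr (hev Y), push X _ z₀ hz₀, push Y _ z₀ hz₀,
    ← hX', ← hY']
  · exact fderiv_lieBracket dX' dY' hu'
  · rw [← hX']; exact hdd X' dX'
  · rw [← hY']; exact hdd Y' dY'

end Commutator

/-! ### Left-invariant vector fields -/

theorem mdifferentiableAt_of_contMDiffOn {E : Type*} [NormedAddCommGroup E] [NormedSpace ℝ E]
    {M : Type*} [TopologicalSpace M] [ChartedSpace E M]
    {V : Type*} [NormedAddCommGroup V] [NormedSpace ℝ V] {u : M → V} {U : Set M} {g : M}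
    (hU : IsOpen U) (hg : g ∈ U) (hu : ContMDiffOn 𝓘(ℝ, E) 𝓘(ℝ, V) ∞ u U) :
    MDifferentiableAt 𝓘(ℝ, E) 𝓘(ℝ, V) u g :=
  (hu.contMDiffAt (hU.mem_nhds hg)).mdifferentiableAt (by simp)

section LeftInvariant

variable {E : Type*} [NormedAddCommGroup E] [NormedSpace ℝ E]
  {L : Type*} [TopologicalSpace L] [ChartedSpace E L] [Group L]

theorem finrank_groupLieAlgebra :
    Module.finrank ℝ (GroupLieAlgebra 𝓘(ℝ, E) L) = Module.finrank ℝ E := rfl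

instance [FiniteDimensional ℝ E] : FiniteDimensional ℝ (GroupLieAlgebra 𝓘(ℝ, E) L) :=
  inferInstanceAs (FiniteDimensional ℝ E)

theorem mulInvariantVectorField_one (ξ : GroupLieAlgebra 𝓘(ℝ, E) L) :
    mulInvariantVectorField ξ (1 : L) = ξ := by
  have h : ∀ f : L → L, f = id →
      (mfderiv 𝓘(ℝ, E) 𝓘(ℝ, E) f 1 : E →L[ℝ] E) = ContinuousLinearMap.id ℝ E := by
    rintro _ rfl; exact mfderiv_id
  exact congrArg (fun A : E →L[ℝ] E ↦ A ξ) (h (fun x : L ↦ 1 * x) (by ext x; simp))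

variable [LieGroup 𝓘(ℝ, E) ∞ L]

/-- Mathlib's `contMDiff_mulInvariantVectorField` gives only finite smoothness; on a smooth Lie group
the invariant fields are smooth. -/
theorem contMDiff_mulInvariantVectorField_infty (ξ : GroupLieAlgebra 𝓘(ℝ, E) L) :
    ContMDiff 𝓘(ℝ, E) 𝓘(ℝ, E).tangent ∞
      (fun g : L ↦ (⟨g, mulInvariantVectorField ξ g⟩ : TangentBundle 𝓘(ℝ, E) L)) := by
  -- the value at `g` is the derivative of the multiplication at `(g, 1)` applied to `(0, ξ)`
  let fg : L → TangentBundle 𝓘(ℝ, E) L := fun g ↦ TotalSpace.mk' E g 0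
  have sfg : ContMDiff 𝓘(ℝ, E) 𝓘(ℝ, E).tangent ∞ fg := contMDiff_zeroSection _ _
  let fv : L → TangentBundle 𝓘(ℝ, E) L := fun _ ↦ TotalSpace.mk' E 1 ξ
  have sfv : ContMDiff 𝓘(ℝ, E) 𝓘(ℝ, E).tangent ∞ fv := contMDiff_const
  have S₂ : ContMDiff _ _ ∞
    (equivTangentBundleProd 𝓘(ℝ, E) L 𝓘(ℝ, E) L).symm := contMDiff_equivTangentBundleProd_symm
  have S₃ := ContMDiff.contMDiff_tangentMap (contMDiff_mul 𝓘(ℝ, E) ∞ (G := L)) (m := ∞) le_rfl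
  have S := (S₃.comp S₂).comp (sfg.prodMk sfv)
  refine S.congr fun g ↦ ?_
  simp only [Function.comp_apply, tangentMap, fg, fv]
  rw [mfderiv_prod_eq_add_apply ((contMDiff_mul 𝓘(ℝ, E) ∞).mdifferentiableAt (by simp))]
  refine TotalSpace.ext (mul_one g).symm ?_
  have h : ∀ (A : E →L[ℝ] E) (w : E), w = A 0 + w := by simp
  exact heq_of_eq (h _ _)

theorem mdifferentiable_mul_left (a : L) :
    MDifferentiable 𝓘(ℝ, E) 𝓘(ℝ, E) (fun x : L ↦ a * x) :=
  (contMDiff_mul_left (I := 𝓘(ℝ, E)) (n := ∞)).mdifferentiable (by simp)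

theorem mfderiv_mul_left_mulInvariantVectorField (g h : L) (ξ : GroupLieAlgebra 𝓘(ℝ, E) L) :
    mfderiv 𝓘(ℝ, E) 𝓘(ℝ, E) (fun x : L ↦ g * x) h (mulInvariantVectorField ξ h) =
      mulInvariantVectorField ξ (g * h) := by
  have e : (fun x : L ↦ g * h * x) = (fun x ↦ g * x) ∘ (fun x ↦ h * x) := by
    ext x; simp [mul_assoc]
  have h1 : ∀ y : L, y = h → (mfderiv 𝓘(ℝ, E) 𝓘(ℝ, E) (fun x : L ↦ g * x) y : E →L[ℝ] E) =
    mfderiv 𝓘(ℝ, E) 𝓘(ℝ, E) (fun x : L ↦ g * x) h := by rintro _ rfl; rfl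
  have h2 : ∀ f : L → L, f = (fun x ↦ g * x) ∘ (fun x ↦ h * x) →
      (mfderiv 𝓘(ℝ, E) 𝓘(ℝ, E) f 1 : E →L[ℝ] E) =
      (mfderiv 𝓘(ℝ, E) 𝓘(ℝ, E) (fun x : L ↦ g * x) h : E →L[ℝ] E).comp
        (mfderiv 𝓘(ℝ, E) 𝓘(ℝ, E) (fun x : L ↦ h * x) 1 : E →L[ℝ] E) := by
    rintro _ rfl
    rw [← h1 (h * 1) (mul_one h)]
    exact mfderiv_comp (I' := 𝓘(ℝ, E)) 1 (mdifferentiable_mul_left g _)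
      (mdifferentiable_mul_left h 1)
  exact (congrArg (fun A : E →L[ℝ] E ↦ A ξ) (h2 _ e)).symm

theorem mulInvariantVectorField_injective (g : L) :
    Function.Injective
      (fun ξ : GroupLieAlgebra 𝓘(ℝ, E) L ↦ (mulInvariantVectorField ξ g : E)) := by
  intro ξ η h
  have h1 : ∀ y : L, y = 1 → mulInvariantVectorField ξ y = mulInvariantVectorField η y →
      ξ = η := by
    rintro _ rfl h
    rwa [mulInvariantVectorField_one, mulInvariantVectorField_one] at h
  refine h1 (g⁻¹ * g) (inv_mul_cancel g) ?_
  rw [← mfderiv_mul_left_mulInvariantVectorField, ← mfderiv_mul_left_mulInvariantVectorField]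
  exact congrArg (mfderiv 𝓘(ℝ, E) 𝓘(ℝ, E) (fun x : L ↦ g⁻¹ * x) g) h

/-- The left trivialization of the tangent bundle of a Lie group: it sends `ξ` to the value at `g`
of the left-invariant vector field of `ξ`. -/
def leftTriv [FiniteDimensional ℝ E] (g : L) :
    GroupLieAlgebra 𝓘(ℝ, E) L ≃ₗ[ℝ] TangentSpace 𝓘(ℝ, E) g :=
  let A : E →ₗ[ℝ] E := (mfderiv 𝓘(ℝ, E) 𝓘(ℝ, E) (fun x : L ↦ g * x) 1 : E →L[ℝ] E).toLinearMap
  have hA : Function.Injective A := mulInvariantVectorField_injective g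
  show E ≃ₗ[ℝ] E from LinearEquiv.ofBijective A ⟨hA, LinearMap.injective_iff_surjective.1 hA⟩

theorem leftTriv_apply [FiniteDimensional ℝ E] (g : L) (ξ : GroupLieAlgebra 𝓘(ℝ, E) L) :
    leftTriv g ξ = mulInvariantVectorField ξ g := rfl

end LeftInvariant

/-! ### Derivatives along left-invariant vector fields -/

section LeftDerivative

variable {E : Type*} [NormedAddCommGroup E] [NormedSpace ℝ E]
  {L : Type*} [TopologicalSpace L] [ChartedSpace E L] [Group L]
  {V : Type*} [NormedAddCommGroup V] [NormedSpace ℝ V]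
  {W : Type*} [NormedAddCommGroup W] [NormedSpace ℝ W]

/-- `leftD ξ u` is the derivative of the vector-valued function `u` on a Lie group along the
left-invariant vector field with value `ξ` at the identity. -/
def leftD (ξ : GroupLieAlgebra 𝓘(ℝ, E) L) (u : L → V) (g : L) : V :=
  mvfderiv 𝓘(ℝ, E) u g (mulInvariantVectorField ξ g)

variable {ξ η : GroupLieAlgebra 𝓘(ℝ, E) L} {u v : L → V} {a : L → ℝ} {g : L} {U : Set L}

theorem leftD_add_left : leftD (ξ + η) u g = leftD ξ u g + leftD η u g := by
  simp only [leftD, mulInvariantVectorField_add, Pi.add_apply, map_add]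

theorem leftD_smul_left (c : ℝ) : leftD (c • ξ) u g = c • leftD ξ u g := by
  simp only [leftD, mulInvariantVectorField_smul, Pi.smul_apply, map_smul]

/-- The derivative of `u` at `g` along left-invariant vector fields, as a linear map on the Lie
algebra. -/
def leftDₗ (u : L → V) (g : L) : GroupLieAlgebra 𝓘(ℝ, E) L →ₗ[ℝ] V where
  toFun ξ := leftD ξ u g
  map_add' _ _ := leftD_add_left
  map_smul' c _ := leftD_smul_left c

theorem leftD_sub_left : leftD (ξ - η) u g = leftD ξ u g - leftD η u g :=
  map_sub (leftDₗ u g) ξ η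

theorem leftD_zero_left : leftD (0 : GroupLieAlgebra 𝓘(ℝ, E) L) u g = 0 :=
  map_zero (leftDₗ u g)

theorem leftD_congr (h : u =ᶠ[𝓝 g] v) : leftD ξ u g = leftD ξ v g := by
  rw [leftD, leftD, mvfderiv_congr h]

theorem leftD_congr_of_isOpen (hU : IsOpen U) (hg : g ∈ U) (h : EqOn u v U) :
    leftD ξ u g = leftD ξ v g :=
  leftD_congr (h.eventuallyEq_of_mem (hU.mem_nhds hg))

theorem leftD_add (hu : MDifferentiableAt 𝓘(ℝ, E) 𝓘(ℝ, V) u g)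
    (hv : MDifferentiableAt 𝓘(ℝ, E) 𝓘(ℝ, V) v g) :
    leftD ξ (fun x ↦ u x + v x) g = leftD ξ u g + leftD ξ v g := by
  simp only [leftD, mvfderiv_fun_add hu hv, add_apply]

theorem leftD_smul (ha : MDifferentiableAt 𝓘(ℝ, E) 𝓘(ℝ, ℝ) a g)
    (hu : MDifferentiableAt 𝓘(ℝ, E) 𝓘(ℝ, V) u g) :
    leftD ξ (fun x ↦ a x • u x) g = a g • leftD ξ u g + leftD ξ a g • u g := by
  simp only [leftD, mvfderiv_fun_smul ha hu, add_apply,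
    smul_apply, ContinuousLinearMap.smulRight_apply]

theorem leftD_const (c : V) : leftD ξ (fun _ : L ↦ c) g = 0 := by
  simp only [leftD, mvfderiv_const, zero_apply]

theorem leftD_clm (A : V →L[ℝ] W) (hu : MDifferentiableAt 𝓘(ℝ, E) 𝓘(ℝ, V) u g) :
    leftD ξ (fun x ↦ A (u x)) g = A (leftD ξ u g) :=
  mvfderiv_clm_comp A hu _

theorem leftD_const_smul (c : ℝ) (hu : MDifferentiableAt 𝓘(ℝ, E) 𝓘(ℝ, V) u g) :
    leftD ξ (fun x ↦ c • u x) g = c • leftD ξ u g :=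
  leftD_clm (c • ContinuousLinearMap.id ℝ V) hu

theorem leftD_comp {f : V → W} (hf : DifferentiableAt ℝ f (u g))
    (hu : MDifferentiableAt 𝓘(ℝ, E) 𝓘(ℝ, V) u g) :
    leftD ξ (fun x ↦ f (u x)) g = fderiv ℝ f (u g) (leftD ξ u g) := by
  have h := mvfderiv_comp_vector (u := f) (f := u) g hf.mdifferentiableAt hu
    (mulInvariantVectorField ξ g)
  rw [mvfderiv_eq_fderiv] at h
  exact h

variable [LieGroup 𝓘(ℝ, E) ∞ L]

theorem contMDiffOn_leftD (hU : IsOpen U) (hu : ContMDiffOn 𝓘(ℝ, E) 𝓘(ℝ, V) ∞ u U)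
    (ξ : GroupLieAlgebra 𝓘(ℝ, E) L) : ContMDiffOn 𝓘(ℝ, E) 𝓘(ℝ, V) ∞ (leftD ξ u) U :=
  contMDiffOn_mvfderiv_apply hU hu (contMDiff_mulInvariantVectorField_infty ξ).contMDiffOn

theorem mdifferentiableAt_mulInvariantVectorField_infty (ξ : GroupLieAlgebra 𝓘(ℝ, E) L) (g : L) :
    MDifferentiableAt 𝓘(ℝ, E) 𝓘(ℝ, E).tangent
      (fun g : L ↦ (⟨g, mulInvariantVectorField ξ g⟩ : TangentBundle 𝓘(ℝ, E) L)) g :=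
  (contMDiff_mulInvariantVectorField_infty ξ).mdifferentiable (by simp) g

/-- Derivatives along left-invariant vector fields commute up to the Lie bracket. -/
theorem leftD_leftD_sub [FiniteDimensional ℝ E] (hU : IsOpen U) (hg : g ∈ U)
    (hu : ContMDiffOn 𝓘(ℝ, E) 𝓘(ℝ, V) ∞ u U) :
    leftD ξ (leftD η u) g - leftD η (leftD ξ u) g = leftD ⁅ξ, η⁆ u g := by
  rw [leftD, GroupLieAlgebra.bracket_def, leftD, leftD, mulInvariantVector_mlieBracket]
  have := FiniteDimensional.complete ℝ E
  exact mvfderiv_mlieBracket (hu.contMDiffAt (hU.mem_nhds hg))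
    (mdifferentiableAt_mulInvariantVectorField_infty ξ g)
    (mdifferentiableAt_mulInvariantVectorField_infty η g)

/-- Left-invariance of the operators `leftD ξ`. -/
theorem leftD_comp_mul_left (h : L) (hu : MDifferentiableAt 𝓘(ℝ, E) 𝓘(ℝ, V) u (h * g)) :
    leftD ξ (fun x ↦ u (h * x)) g = leftD ξ u (h * g) := by
  rw [leftD, leftD, ← mfderiv_mul_left_mulInvariantVectorField]
  exact mvfderiv_comp_vector (u := u) (f := fun x ↦ h * x) g hu (mdifferentiable_mul_left h g) _

/-- Elements of the Lie algebra are separated by their action on smooth functions at the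
identity. -/
theorem leftD_extChartAt_injective :
    Function.Injective (fun ξ : GroupLieAlgebra 𝓘(ℝ, E) L ↦ leftD ξ (chartAt E (1 : L)) 1) := by
  intro ξ η h
  have := (mdifferentiable_chart (I := 𝓘(ℝ, E)) (1 : L)).mfderiv_injective (mem_chart_source E 1)
  simp only [leftD, mulInvariantVectorField_one] at h
  exact this h

end LeftDerivative

/-! ### Homomorphisms of Lie groups -/

section Homs

variable {E : Type*} [NormedAddCommGroup E] [NormedSpace ℝ E]
  {L : Type*} [TopologicalSpace L] [ChartedSpace E L] [Group L] [LieGroup 𝓘(ℝ, E) ∞ L]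
  {E' : Type*} [NormedAddCommGroup E'] [NormedSpace ℝ E']
  {L' : Type*} [TopologicalSpace L'] [ChartedSpace E' L'] [Group L'] [LieGroup 𝓘(ℝ, E') ∞ L']
  {V : Type*} [NormedAddCommGroup V] [NormedSpace ℝ V]

variable (E E') in
/-- The derivative at the identity of a homomorphism of Lie groups. -/
def homDeriv (p : L →* L') : GroupLieAlgebra 𝓘(ℝ, E) L →ₗ[ℝ] GroupLieAlgebra 𝓘(ℝ, E') L' :=
  (show E →ₗ[ℝ] E' from
    (mfderiv 𝓘(ℝ, E) 𝓘(ℝ, E') p 1 : E →L[ℝ] E').toLinearMap)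

/-- A homomorphism of Lie groups relates left-invariant vector fields to left-invariant ones. -/
theorem leftD_comp_hom (p : L →* L') (hp : ContMDiff 𝓘(ℝ, E) 𝓘(ℝ, E') ∞ p) {u : L' → V} {g : L}
    (hu : MDifferentiableAt 𝓘(ℝ, E') 𝓘(ℝ, V) u (p g)) (ξ : GroupLieAlgebra 𝓘(ℝ, E) L) :
    leftD ξ (fun x ↦ u (p x)) g = leftD (homDeriv E E' p ξ) u (p g) := by
  have hpd := hp.mdifferentiable (by simp)
  have e : mfderiv 𝓘(ℝ, E) 𝓘(ℝ, E') p g (mulInvariantVectorField ξ g) =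
      mulInvariantVectorField (homDeriv E E' p ξ : GroupLieAlgebra 𝓘(ℝ, E') L') (p g) := by
    have h1 : ∀ y : L, y = g → (mfderiv 𝓘(ℝ, E) 𝓘(ℝ, E') p y : E →L[ℝ] E') =
      mfderiv 𝓘(ℝ, E) 𝓘(ℝ, E') p g := by rintro _ rfl; rfl
    have h2 : ∀ y : L', y = 1 →
        (mfderiv 𝓘(ℝ, E') 𝓘(ℝ, E') (fun x : L' ↦ p g * x) y : E' →L[ℝ] E') =
        mfderiv 𝓘(ℝ, E') 𝓘(ℝ, E') (fun x : L' ↦ p g * x) 1 := by rintro _ rfl; rfl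
    have h3 : (mfderiv 𝓘(ℝ, E) 𝓘(ℝ, E') (fun x ↦ p (g * x)) 1 : E →L[ℝ] E') =
        (mfderiv 𝓘(ℝ, E) 𝓘(ℝ, E') p g : E →L[ℝ] E').comp
          (mfderiv 𝓘(ℝ, E) 𝓘(ℝ, E) (fun x : L ↦ g * x) 1 : E →L[ℝ] E) := by
      rw [← h1 (g * 1) (mul_one g)]
      exact mfderiv_comp (I' := 𝓘(ℝ, E)) 1 (hpd _) (mdifferentiable_mul_left g 1)
    have h4 : (mfderiv 𝓘(ℝ, E) 𝓘(ℝ, E') (fun x ↦ p g * p x) 1 : E →L[ℝ] E') =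
        (mfderiv 𝓘(ℝ, E') 𝓘(ℝ, E') (fun x : L' ↦ p g * x) 1 : E' →L[ℝ] E').comp
          (mfderiv 𝓘(ℝ, E) 𝓘(ℝ, E') p 1 : E →L[ℝ] E') := by
      rw [← h2 (p 1) (map_one p)]
      exact mfderiv_comp (I' := 𝓘(ℝ, E')) 1 (mdifferentiable_mul_left (p g) _) (hpd 1)
    have h5 : ∀ f : L → L', f = (fun x ↦ p g * p x) →
        (mfderiv 𝓘(ℝ, E) 𝓘(ℝ, E') f 1 : E →L[ℝ] E') =
          mfderiv 𝓘(ℝ, E) 𝓘(ℝ, E') (fun x ↦ p g * p x) 1 := by rintro _ rfl; rfl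
    exact congrArg (fun A : E →L[ℝ] E' ↦ A ξ)
      (h3.symm.trans ((h5 _ (by ext x; simp)).trans h4))
  rw [leftD, leftD, ← e]
  exact mvfderiv_comp_vector (u := u) (f := p) g hu (hpd g) _

/-- The derivative of a homomorphism respects the brackets: both sides act in the same way on the
functions pulled back from a chart at the identity. -/
theorem homDeriv_lie [FiniteDimensional ℝ E] [FiniteDimensional ℝ E'] (p : L →* L')
    (hp : ContMDiff 𝓘(ℝ, E) 𝓘(ℝ, E') ∞ p)
    (ξ η : GroupLieAlgebra 𝓘(ℝ, E) L) :
    homDeriv E E' p ⁅ξ, η⁆ =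
      (⁅homDeriv E E' p ξ, homDeriv E E' p η⁆ : GroupLieAlgebra 𝓘(ℝ, E') L') := by
  apply leftD_extChartAt_injective
  let u : L' → E' := ⇑(chartAt E' (1 : L'))
  let U := (chartAt E' (1 : L')).source
  have hU : IsOpen U := (chartAt E' (1 : L')).open_source
  have h1 : (1 : L') ∈ U := mem_chart_source E' 1
  have hu : ContMDiffOn 𝓘(ℝ, E') 𝓘(ℝ, E') ∞ u U := contMDiffOn_chart
  have hU' : IsOpen (p ⁻¹' U) := hU.preimage hp.continuous
  have h1' : (1 : L) ∈ p ⁻¹' U := by simpa using h1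
  have hu' : ContMDiffOn 𝓘(ℝ, E) 𝓘(ℝ, E') ∞ (fun x ↦ u (p x)) (p ⁻¹' U) :=
    hu.comp hp.contMDiffOn (fun x hx ↦ hx)
  have hD : ∀ α β : GroupLieAlgebra 𝓘(ℝ, E) L, leftD α (leftD β (fun x ↦ u (p x))) 1 =
      leftD (homDeriv E E' p α) (leftD (homDeriv E E' p β) u) 1 := by
    intro α β
    rw [leftD_congr_of_isOpen hU' h1' (v := fun x ↦ leftD (homDeriv E E' p β) u (p x)) fun x hx ↦
      leftD_comp_hom p hp (mdifferentiableAt_of_contMDiffOn hU hx hu) β,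
      leftD_comp_hom p hp (mdifferentiableAt_of_contMDiffOn hU h1' (contMDiffOn_leftD hU hu _)),
      map_one]
  have h := leftD_leftD_sub (ξ := ξ) (η := η) hU' h1' hu'
  rw [hD, hD, leftD_leftD_sub hU h1 hu,
    leftD_comp_hom p hp (mdifferentiableAt_of_contMDiffOn hU h1' hu), map_one] at h
  exact h.symm

end Homs

/-! ### Homogeneous lifts and their products -/

theorem mdifferentiableAt_fun_smul {E : Type*} [NormedAddCommGroup E] [NormedSpace ℝ E]
    {M : Type*} [TopologicalSpace M] [ChartedSpace E M]
    {V : Type*} [NormedAddCommGroup V] [NormedSpace ℝ V] {a : M → ℝ} {u : M → V} {g : M}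
    (ha : MDifferentiableAt 𝓘(ℝ, E) 𝓘(ℝ, ℝ) a g) (hu : MDifferentiableAt 𝓘(ℝ, E) 𝓘(ℝ, V) u g) :
    MDifferentiableAt 𝓘(ℝ, E) 𝓘(ℝ, V) (fun x ↦ a x • u x) g := ha.smul hu

section Lift

variable {E : Type*} [NormedAddCommGroup E] [NormedSpace ℝ E]
  {L : Type*} [TopologicalSpace L] [ChartedSpace E L] [Group L]
  {V : Type*} [NormedAddCommGroup V] [NormedSpace ℝ V]
  {W : Type*} [NormedAddCommGroup W] [NormedSpace ℝ W]

/-- A homogeneous lift of a left-invariant flat projective structure near the identity of `L`: a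
map `F` from an open neighbourhood `U` of `1` to a vector space `V` of dimension `dim L + 1` such
that the derivatives of `F` of first order together with `F` span `V` at `1`, and such that each
derivative of second order along left-invariant fields is a linear combination of these with
constant coefficients. In the projective space of `V`, `F` is a developing map of the structure. -/
structure IsHomogeneousLift (U : Set L) (F : L → V) : Prop where
  isOpen : IsOpen U
  one_mem : (1 : L) ∈ U
  smooth : ContMDiffOn 𝓘(ℝ, E) 𝓘(ℝ, V) ∞ F U
  second : ∀ ξ η : GroupLieAlgebra 𝓘(ℝ, E) L, ∃ (ζ : GroupLieAlgebra 𝓘(ℝ, E) L) (c : ℝ),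
    ∀ g ∈ U, leftD ξ (leftD η F) g = leftD ζ F g + c • F g
  finrank_eq : Module.finrank ℝ V = Module.finrank ℝ E + 1
  independent : ∀ (ξ : GroupLieAlgebra 𝓘(ℝ, E) L) (c : ℝ),
    leftD ξ F 1 + c • F 1 = 0 → ξ = 0 ∧ c = 0

variable (E L) in
/-- The Lie group `L` has a homogeneous lift near the identity. -/
def HasHomogeneousLift : Prop :=
  ∃ (V : Type) (_ : NormedAddCommGroup V) (_ : NormedSpace ℝ V) (_ : FiniteDimensional ℝ V)
    (U : Set L) (F : L → V), IsHomogeneousLift (E := E) U F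

theorem leftD_prodMk {ξ : GroupLieAlgebra 𝓘(ℝ, E) L} {u : L → V} {v : L → W} {g : L}
    (hu : MDifferentiableAt 𝓘(ℝ, E) 𝓘(ℝ, V) u g) (hv : MDifferentiableAt 𝓘(ℝ, E) 𝓘(ℝ, W) v g) :
    leftD ξ (fun x ↦ (u x, v x)) g = (leftD ξ u g, leftD ξ v g) := by
  have h : MDifferentiableAt 𝓘(ℝ, E) 𝓘(ℝ, V × W) (fun x ↦ (u x, v x)) g := hu.prodMk_space hv
  exact Prod.ext (leftD_clm (ContinuousLinearMap.fst ℝ V W) h).symm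
    (leftD_clm (ContinuousLinearMap.snd ℝ V W) h).symm

/-- A multiplicative function is an eigenfunction of the derivatives along left-invariant fields. -/
theorem leftD_eq_mul_of_map_mul {a : L → ℝ} [LieGroup 𝓘(ℝ, E) ∞ L]
    (ha : MDifferentiable 𝓘(ℝ, E) 𝓘(ℝ, ℝ) a)
    (hmul : ∀ x y, a (x * y) = a x * a y) (ξ : GroupLieAlgebra 𝓘(ℝ, E) L) (g : L) :
    leftD ξ a g = leftD ξ a 1 * a g := by
  have h := leftD_comp_mul_left (ξ := ξ) (u := a) (g := 1) g (ha _)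
  simp only [hmul, mul_one] at h
  rw [← h, mul_comm]
  exact leftD_const_smul (a g) (ha 1)

end Lift

section Product

variable {E : Type*} [NormedAddCommGroup E] [NormedSpace ℝ E]
  {L : Type*} [TopologicalSpace L] [ChartedSpace E L] [Group L] [LieGroup 𝓘(ℝ, E) ∞ L]
  {E₁ : Type*} [NormedAddCommGroup E₁] [NormedSpace ℝ E₁]
  {L₁ : Type*} [TopologicalSpace L₁] [ChartedSpace E₁ L₁] [Group L₁] [LieGroup 𝓘(ℝ, E₁) ∞ L₁]
  {E₂ : Type*} [NormedAddCommGroup E₂] [NormedSpace ℝ E₂]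
  {L₂ : Type*} [TopologicalSpace L₂] [ChartedSpace E₂ L₂] [Group L₂] [LieGroup 𝓘(ℝ, E₂) ∞ L₂]
  {V₁ : Type*} [NormedAddCommGroup V₁] [NormedSpace ℝ V₁] [FiniteDimensional ℝ V₁]
  {V₂ : Type*} [NormedAddCommGroup V₂] [NormedSpace ℝ V₂] [FiniteDimensional ℝ V₂]

/-- If `F₁`, `F₂` are homogeneous lifts on `L₁`, `L₂` and `a` is a character, then `(a F₁, F₂)` is a
homogeneous lift on any group which is infinitesimally the product of `L₁`, `L₂` and the target
of `a`. -/
theorem IsHomogeneousLift.prod {U₁ : Set L₁} {F₁ : L₁ → V₁} {U₂ : Set L₂} {F₂ : L₂ → V₂}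
    (h₁ : IsHomogeneousLift (E := E₁) U₁ F₁) (h₂ : IsHomogeneousLift (E := E₂) U₂ F₂)
    (p₁ : L →* L₁) (hp₁ : ContMDiff 𝓘(ℝ, E) 𝓘(ℝ, E₁) ∞ p₁)
    (p₂ : L →* L₂) (hp₂ : ContMDiff 𝓘(ℝ, E) 𝓘(ℝ, E₂) ∞ p₂)
    (a : L →* ℝ) (ha : ContMDiff 𝓘(ℝ, E) 𝓘(ℝ, ℝ) ∞ a)
    (hdim : Module.finrank ℝ E = Module.finrank ℝ E₁ + Module.finrank ℝ E₂ + 1)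
    (hbij : Function.Bijective (fun ξ : GroupLieAlgebra 𝓘(ℝ, E) L ↦
      (homDeriv E E₁ p₁ ξ, homDeriv E E₂ p₂ ξ, leftD ξ a 1))) :
    IsHomogeneousLift (E := E) (p₁ ⁻¹' U₁ ∩ p₂ ⁻¹' U₂)
      (fun x ↦ (a x • F₁ (p₁ x), F₂ (p₂ x))) := by
  have hO₁ : IsOpen (p₁ ⁻¹' U₁) := h₁.isOpen.preimage hp₁.continuous
  have hO₂ : IsOpen (p₂ ⁻¹' U₂) := h₂.isOpen.preimage hp₂.continuous
  have hO := hO₁.inter hO₂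
  have hone : (1 : L) ∈ p₁ ⁻¹' U₁ ∩ p₂ ⁻¹' U₂ := by simpa using ⟨h₁.one_mem, h₂.one_mem⟩
  have hG₁ : ∀ {u : L₁ → V₁}, ContMDiffOn 𝓘(ℝ, E₁) 𝓘(ℝ, V₁) ∞ u U₁ →
      ContMDiffOn 𝓘(ℝ, E) 𝓘(ℝ, V₁) ∞ (fun x ↦ u (p₁ x)) (p₁ ⁻¹' U₁ ∩ p₂ ⁻¹' U₂) :=
    fun hu ↦ hu.comp hp₁.contMDiffOn (fun x hx ↦ hx.1)
  have hG₂ : ∀ {u : L₂ → V₂}, ContMDiffOn 𝓘(ℝ, E₂) 𝓘(ℝ, V₂) ∞ u U₂ →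
      ContMDiffOn 𝓘(ℝ, E) 𝓘(ℝ, V₂) ∞ (fun x ↦ u (p₂ x)) (p₁ ⁻¹' U₁ ∩ p₂ ⁻¹' U₂) :=
    fun hu ↦ hu.comp hp₂.contMDiffOn (fun x hx ↦ hx.2)
  have had := ha.mdifferentiable (by simp)
  have haD : ∀ (ξ : GroupLieAlgebra 𝓘(ℝ, E) L) (g : L), leftD ξ a g = leftD ξ a 1 * a g :=
    fun ξ g ↦ leftD_eq_mul_of_map_mul had (map_mul a) ξ g
  -- the first derivatives
  have hfirst : ∀ (ξ : GroupLieAlgebra 𝓘(ℝ, E) L), ∀ g ∈ p₁ ⁻¹' U₁ ∩ p₂ ⁻¹' U₂,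
      leftD ξ (fun x ↦ (a x • F₁ (p₁ x), F₂ (p₂ x))) g =
        (a g • (leftD (homDeriv E E₁ p₁ ξ) F₁ (p₁ g) + leftD ξ a 1 • F₁ (p₁ g)),
          leftD (homDeriv E E₂ p₂ ξ) F₂ (p₂ g)) := by
    intro ξ g hg
    have d₁ := mdifferentiableAt_of_contMDiffOn hO hg (hG₁ h₁.smooth)
    have d₂ := mdifferentiableAt_of_contMDiffOn hO hg (hG₂ h₂.smooth)
    rw [leftD_prodMk (mdifferentiableAt_fun_smul (had g) d₁) d₂, leftD_smul (had g) d₁, haD,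
      leftD_comp_hom p₁ hp₁ (mdifferentiableAt_of_contMDiffOn h₁.isOpen hg.1 h₁.smooth),
      leftD_comp_hom p₂ hp₂ (mdifferentiableAt_of_contMDiffOn h₂.isOpen hg.2 h₂.smooth)]
    congr 1
    module
  refine ⟨hO, hone, ?_, ?_, ?_, ?_⟩
  · exact (ha.contMDiffOn.smul (hG₁ h₁.smooth)).prodMk_space (hG₂ h₂.smooth)
  · intro ξ η
    obtain ⟨ζ₁, c₁, e₁⟩ := h₁.second (homDeriv E E₁ p₁ ξ) (homDeriv E E₁ p₁ η)
    obtain ⟨ζ₂, c₂, e₂⟩ := h₂.second (homDeriv E E₂ p₂ ξ) (homDeriv E E₂ p₂ η)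
    -- the scaling direction absorbs the difference of the two zeroth-order coefficients
    obtain ⟨ζ, hζ⟩ := hbij.2 (ζ₁ + leftD η a 1 • homDeriv E E₁ p₁ ξ +
      leftD ξ a 1 • homDeriv E E₁ p₁ η, ζ₂, c₁ + leftD ξ a 1 * leftD η a 1 - c₂)
    simp only [Prod.mk.injEq] at hζ
    obtain ⟨hζ₁, hζ₂, hζa⟩ := hζ
    refine ⟨ζ, c₂, fun g hg ↦ ?_⟩
    have s₁ := contMDiffOn_leftD h₁.isOpen h₁.smooth (homDeriv E E₁ p₁ η)
    have s₂ := contMDiffOn_leftD h₂.isOpen h₂.smooth (homDeriv E E₂ p₂ η)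
    have d₁ := mdifferentiableAt_of_contMDiffOn hO hg (hG₁ s₁)
    have d₁' := mdifferentiableAt_of_contMDiffOn hO hg (hG₁ h₁.smooth)
    have d₂ := mdifferentiableAt_of_contMDiffOn hO hg (hG₂ s₂)
    have d₁'' : MDifferentiableAt 𝓘(ℝ, E) 𝓘(ℝ, V₁)
      (fun x ↦ leftD η a 1 • F₁ (p₁ x)) g := d₁'.const_smul (leftD η a 1)
    have d₃ : MDifferentiableAt 𝓘(ℝ, E) 𝓘(ℝ, V₁)
      (fun x ↦ leftD (homDeriv E E₁ p₁ η) F₁ (p₁ x) + leftD η a 1 • F₁ (p₁ x)) g := d₁.add d₁''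
    rw [leftD_congr_of_isOpen hO hg (hfirst η),
      leftD_prodMk (mdifferentiableAt_fun_smul (had g) d₃) d₂,
      leftD_smul (had g) d₃, haD ξ g, leftD_add d₁ d₁'', leftD_const_smul _ d₁',
      leftD_comp_hom p₁ hp₁ (mdifferentiableAt_of_contMDiffOn h₁.isOpen hg.1 s₁),
      leftD_comp_hom p₁ hp₁ (mdifferentiableAt_of_contMDiffOn h₁.isOpen hg.1 h₁.smooth),
      leftD_comp_hom p₂ hp₂ (mdifferentiableAt_of_contMDiffOn h₂.isOpen hg.2 s₂),
      e₁ _ hg.1, e₂ _ hg.2, hfirst ζ g hg, hζ₁, hζ₂, hζa]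
    simp only [leftD_add_left, leftD_smul_left, Prod.smul_mk, Prod.mk_add_mk]
    congr 1
    module
  · rw [Module.finrank_prod, h₁.finrank_eq, h₂.finrank_eq, hdim]; ring
  · intro ξ c h
    rw [hfirst ξ 1 hone] at h
    simp only [map_one, one_smul, Prod.smul_mk, Prod.mk_add_mk, Prod.mk_eq_zero] at h
    obtain ⟨k₁, k₁'⟩ := h₁.independent (homDeriv E E₁ p₁ ξ) (leftD ξ a 1 + c)
      (by rw [← h.1]; module)
    obtain ⟨k₂, rfl⟩ := h₂.independent (homDeriv E E₂ p₂ ξ) c h.2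
    refine ⟨hbij.1 ?_, rfl⟩
    rw [add_zero] at k₁'
    simp only [k₁, k₂, k₁', map_zero, leftD_zero_left]

end Product

/-! ### Homogeneous lifts in dimensions zero and one -/

section Units

theorem leftD_units_val_injective :
    Function.Injective (fun ξ : GroupLieAlgebra 𝓘(ℝ, ℝ) ℝˣ ↦ leftD ξ (fun t : ℝˣ ↦ (t : ℝ)) 1) :=
  leftD_extChartAt_injective (E := ℝ) (L := ℝˣ)

theorem isHomogeneousLift_units :
    IsHomogeneousLift (E := ℝ) (univ : Set ℝˣ) (fun t : ℝˣ ↦ ((t : ℝ), (1 : ℝ))) := by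
  have hs : ContMDiff 𝓘(ℝ, ℝ) 𝓘(ℝ, ℝ) ∞ (fun t : ℝˣ ↦ (t : ℝ)) := Units.contMDiff_val
  have hd := hs.mdifferentiable (by simp)
  have h1 : ∀ (ξ : GroupLieAlgebra 𝓘(ℝ, ℝ) ℝˣ) (g : ℝˣ),
      leftD ξ (fun t : ℝˣ ↦ ((t : ℝ), (1 : ℝ))) g =
        (leftD ξ (fun t : ℝˣ ↦ (t : ℝ)) 1 * (g : ℝ), 0) := by
    intro ξ g
    rw [leftD_prodMk (hd g) mdifferentiableAt_const, leftD_const,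
      leftD_eq_mul_of_map_mul hd (fun _ _ ↦ Units.val_mul _ _)]
  refine ⟨isOpen_univ, mem_univ _, ?_, fun ξ η ↦
    ⟨leftD ξ (fun t : ℝˣ ↦ (t : ℝ)) 1 • η, 0, fun g _ ↦ ?_⟩, by simp, fun ξ c h ↦ ?_⟩
  · exact (hs.prodMk_space contMDiff_const).contMDiffOn
  · have h2 : leftD η (fun t : ℝˣ ↦ ((t : ℝ), (1 : ℝ))) =
        fun g : ℝˣ ↦ (leftD η (fun t : ℝˣ ↦ (t : ℝ)) 1 • (g : ℝ), (0 : ℝ)) := funext (h1 η)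
    rw [leftD_smul_left, h1, h2,
      leftD_prodMk (mdifferentiableAt_fun_smul mdifferentiableAt_const (hd g))
        mdifferentiableAt_const,
      leftD_const, leftD_const_smul _ (hd g),
      leftD_eq_mul_of_map_mul hd (fun _ _ ↦ Units.val_mul _ _) ξ g]
    simp only [Prod.smul_mk, smul_eq_mul, Prod.mk_add_mk]
    refine Prod.ext ?_ ?_
    · simp only [add_zero, zero_mul]; ring
    · simp
  · rw [h1] at h
    simp only [Prod.smul_mk, Prod.mk_add_mk, Prod.mk_eq_zero, smul_eq_mul, Units.val_one,
      mul_one, zero_add] at h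
    obtain ⟨h, rfl⟩ := h
    refine ⟨leftD_units_val_injective ?_, rfl⟩
    simpa only [leftD_zero_left, add_zero] using h

end Units

section LowDimension

variable {E : Type*} [NormedAddCommGroup E] [NormedSpace ℝ E] [FiniteDimensional ℝ E]
  {L : Type*} [TopologicalSpace L] [ChartedSpace E L] [Group L]

/-- In dimension zero there are no derivatives, and the constant `1` spans the line `ℝ`. -/
theorem isHomogeneousLift_const (h : Module.finrank ℝ E = 0) :
    IsHomogeneousLift (E := E) (univ : Set L) (fun _ ↦ (1 : ℝ)) := by
  have hsub : Subsingleton E := Module.finrank_zero_iff.1 h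
  refine ⟨isOpen_univ, mem_univ _, contMDiffOn_const, fun ξ η ↦ ⟨0, 0, fun g _ ↦ ?_⟩, by simp [h],
    fun ξ c hc ↦ ⟨Subsingleton.elim (α := E) _ _, ?_⟩⟩
  · rw [Subsingleton.elim (α := E) ξ (0 : GroupLieAlgebra 𝓘(ℝ, E) L), leftD_zero_left,
      leftD_zero_left]
    simp
  · simpa [leftD_const] using hc

theorem isLieAbelian_of_finrank_eq_one {𝔩 : Type*} [LieRing 𝔩] [LieAlgebra ℝ 𝔩]
    (h : Module.finrank ℝ 𝔩 = 1) : IsLieAbelian 𝔩 := by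
  obtain ⟨v, -, hv⟩ := finrank_eq_one_iff'.1 h
  refine ⟨fun x y ↦ ?_⟩
  obtain ⟨a, rfl⟩ := hv x
  obtain ⟨b, rfl⟩ := hv y
  simp

theorem nonempty_lieEquiv_of_finrank_eq_one {𝔩 𝔩' : Type*} [LieRing 𝔩] [LieAlgebra ℝ 𝔩]
    [LieRing 𝔩'] [LieAlgebra ℝ 𝔩'] (h : Module.finrank ℝ 𝔩 = 1) (h' : Module.finrank ℝ 𝔩' = 1) :
    Nonempty (𝔩 ≃ₗ⁅ℝ⁆ 𝔩') := by
  have := isLieAbelian_of_finrank_eq_one h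
  have := isLieAbelian_of_finrank_eq_one h'
  have : FiniteDimensional ℝ 𝔩 := FiniteDimensional.of_finrank_eq_succ h
  have : FiniteDimensional ℝ 𝔩' := FiniteDimensional.of_finrank_eq_succ h'
  let e := LinearEquiv.ofFinrankEq 𝔩 𝔩' (h.trans h'.symm)
  have he : ∀ x y : 𝔩, e ⁅x, y⁆ = ⁅e x, e y⁆ := fun x y ↦ by
    rw [trivial_lie_zero, trivial_lie_zero, map_zero]
  exact ⟨{ e with map_lie' := fun {x y} ↦ he x y }⟩

end LowDimension

/-! ### Products of Lie groups -/

theorem homDeriv_comp {E : Type*} [NormedAddCommGroup E] [NormedSpace ℝ E]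
    {L : Type*} [TopologicalSpace L] [ChartedSpace E L] [Group L]
    {E' : Type*} [NormedAddCommGroup E'] [NormedSpace ℝ E']
    {L' : Type*} [TopologicalSpace L'] [ChartedSpace E' L'] [Group L']
    {E'' : Type*} [NormedAddCommGroup E''] [NormedSpace ℝ E'']
    {L'' : Type*} [TopologicalSpace L''] [ChartedSpace E'' L''] [Group L'']
    (q : L' →* L'') (p : L →* L') (hq : MDifferentiable 𝓘(ℝ, E') 𝓘(ℝ, E'') q)
    (hp : MDifferentiable 𝓘(ℝ, E) 𝓘(ℝ, E') p) (ξ : GroupLieAlgebra 𝓘(ℝ, E) L) :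
    homDeriv E E'' (q.comp p) ξ = homDeriv E' E'' q (homDeriv E E' p ξ) := by
  have h1 : ∀ y : L', y = 1 → (mfderiv 𝓘(ℝ, E') 𝓘(ℝ, E'') q y : E' →L[ℝ] E'') =
    mfderiv 𝓘(ℝ, E') 𝓘(ℝ, E'') q 1 := by rintro _ rfl; rfl
  have h2 : (mfderiv 𝓘(ℝ, E) 𝓘(ℝ, E'') (q ∘ p) 1 : E →L[ℝ] E'') =
      (mfderiv 𝓘(ℝ, E') 𝓘(ℝ, E'') q 1 : E' →L[ℝ] E'').comp
        (mfderiv 𝓘(ℝ, E) 𝓘(ℝ, E') p 1 : E →L[ℝ] E') := by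
    rw [← h1 (p 1) (map_one p)]
    exact mfderiv_comp (I' := 𝓘(ℝ, E')) 1 (hq _) (hp 1)
  exact congrArg (fun A : E →L[ℝ] E'' ↦ A ξ) h2

section ProductGroup

variable {E : Type*} [NormedAddCommGroup E] [NormedSpace ℝ E]
  {L : Type*} [TopologicalSpace L] [ChartedSpace E L]
  {E' : Type*} [NormedAddCommGroup E'] [NormedSpace ℝ E']
  {L' : Type*} [TopologicalSpace L'] [ChartedSpace E' L']

/-- The product manifold, modelled on the product vector space. This is Mathlib's charted space
structure on a product, up to the identification of `ModelProd E E'` with `E × E'`. -/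
@[reducible] def chartedSpaceProd : ChartedSpace (E × E') (L × L') :=
  prodChartedSpace E L E' L'

attribute [local instance] chartedSpaceProd

theorem contMDiff_fst_self : ContMDiff 𝓘(ℝ, E × E') 𝓘(ℝ, E) ∞ (Prod.fst : L × L' → L) := by
  rw [modelWithCornersSelf_prod]
  exact contMDiff_fst

theorem contMDiff_snd_self : ContMDiff 𝓘(ℝ, E × E') 𝓘(ℝ, E') ∞ (Prod.snd : L × L' → L') := by
  rw [modelWithCornersSelf_prod]
  exact contMDiff_snd

variable [Group L] [Group L']

theorem lieGroup_prod [LieGroup 𝓘(ℝ, E) ∞ L] [LieGroup 𝓘(ℝ, E') ∞ L'] :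
    LieGroup 𝓘(ℝ, E × E') ∞ (L × L') := by
  rw [modelWithCornersSelf_prod]
  exact (inferInstance : LieGroup (𝓘(ℝ, E).prod 𝓘(ℝ, E')) ∞ (L × L'))

theorem homDeriv_fst (ξ : GroupLieAlgebra 𝓘(ℝ, E × E') (L × L')) :
    homDeriv (E × E') E (MonoidHom.fst L L') ξ = (show E × E' from ξ).1 := by
  have h : (mfderiv 𝓘(ℝ, E × E') 𝓘(ℝ, E) (Prod.fst : L × L' → L) 1 : E × E' →L[ℝ] E) =
      ContinuousLinearMap.fst ℝ E E' := by
    rw [modelWithCornersSelf_prod]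
    exact mfderiv_fst
  exact congrArg (fun A : E × E' →L[ℝ] E ↦ A ξ) h

theorem homDeriv_snd (ξ : GroupLieAlgebra 𝓘(ℝ, E × E') (L × L')) :
    homDeriv (E × E') E' (MonoidHom.snd L L') ξ = (show E × E' from ξ).2 := by
  have h : (mfderiv 𝓘(ℝ, E × E') 𝓘(ℝ, E') (Prod.snd : L × L' → L') 1 : E × E' →L[ℝ] E') =
      ContinuousLinearMap.snd ℝ E E' := by
    rw [modelWithCornersSelf_prod]
    exact mfderiv_snd
  exact congrArg (fun A : E × E' →L[ℝ] E' ↦ A ξ) h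

variable [FiniteDimensional ℝ E] [FiniteDimensional ℝ E']
  [LieGroup 𝓘(ℝ, E) ∞ L] [LieGroup 𝓘(ℝ, E') ∞ L']

attribute [local instance] lieGroup_prod

/-- The Lie algebra of a product of Lie groups is the product of the Lie algebras. -/
def groupLieAlgebraProdEquiv :
    GroupLieAlgebra 𝓘(ℝ, E × E') (L × L') ≃ₗ⁅ℝ⁆
      GroupLieAlgebra 𝓘(ℝ, E) L × GroupLieAlgebra 𝓘(ℝ, E') L' :=
  let f := (homDeriv (E × E') E (MonoidHom.fst L L')).prod
    (homDeriv (E × E') E' (MonoidHom.snd L L'))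
  have hf : ∀ ξ, f ξ = ((show E × E' from ξ).1, (show E × E' from ξ).2) := fun ξ ↦
    Prod.ext (homDeriv_fst ξ) (homDeriv_snd ξ)
  have hb : Function.Bijective f :=
    ⟨fun ξ η h ↦ by rw [hf, hf] at h; exact h, fun ζ ↦ ⟨(show E × E' from ζ), hf _⟩⟩
  { LinearEquiv.ofBijective f hb with
    map_lie' := fun {ξ η} ↦ Prod.ext (homDeriv_lie _ contMDiff_fst_self ξ η)
      (homDeriv_lie _ contMDiff_snd_self ξ η) }

end ProductGroup

section TripleProduct

variable {E₁ : Type} [NormedAddCommGroup E₁] [NormedSpace ℝ E₁] [FiniteDimensional ℝ E₁]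
  {L₁ : Type} [TopologicalSpace L₁] [ChartedSpace E₁ L₁] [Group L₁] [LieGroup 𝓘(ℝ, E₁) ∞ L₁]
  {E₂ : Type} [NormedAddCommGroup E₂] [NormedSpace ℝ E₂] [FiniteDimensional ℝ E₂]
  {L₂ : Type} [TopologicalSpace L₂] [ChartedSpace E₂ L₂] [Group L₂] [LieGroup 𝓘(ℝ, E₂) ∞ L₂]

attribute [local instance] chartedSpaceProd lieGroup_prod

/-- The factor `ℝˣ` acts by scaling on the first lift. -/
theorem HasHomogeneousLift.prod_units (h₁ : HasHomogeneousLift E₁ L₁)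
    (h₂ : HasHomogeneousLift E₂ L₂) : HasHomogeneousLift (E₁ × E₂ × ℝ) (L₁ × L₂ × ℝˣ) := by
  obtain ⟨V₁, _, _, _, U₁, F₁, h₁⟩ := h₁
  obtain ⟨V₂, _, _, _, U₂, F₂, h₂⟩ := h₂
  let p₂₃ := MonoidHom.snd L₁ (L₂ × ℝˣ)
  let p₂ := (MonoidHom.fst L₂ ℝˣ).comp p₂₃
  let p₃ := (MonoidHom.snd L₂ ℝˣ).comp p₂₃
  have hp₂₃ : ContMDiff 𝓘(ℝ, E₁ × E₂ × ℝ) 𝓘(ℝ, E₂ × ℝ) ∞ p₂₃ := contMDiff_snd_self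
  have hp₂ : ContMDiff 𝓘(ℝ, E₁ × E₂ × ℝ) 𝓘(ℝ, E₂) ∞ p₂ := contMDiff_fst_self.comp hp₂₃
  have hp₃ : ContMDiff 𝓘(ℝ, E₁ × E₂ × ℝ) 𝓘(ℝ, ℝ) ∞ p₃ := contMDiff_snd_self.comp hp₂₃
  refine ⟨V₁ × V₂, inferInstance, inferInstance, inferInstance, _, _,
    h₁.prod h₂ (MonoidHom.fst L₁ (L₂ × ℝˣ)) contMDiff_fst_self p₂ hp₂
      ((Units.coeHom ℝ).comp p₃) (Units.contMDiff_val.comp hp₃) ?_ ?_⟩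
  · simp only [Module.finrank_prod, Module.finrank_self]; ring
  · have e₂ : ∀ ξ : GroupLieAlgebra 𝓘(ℝ, E₁ × E₂ × ℝ) (L₁ × L₂ × ℝˣ),
        homDeriv (E₁ × E₂ × ℝ) E₂ p₂ ξ = (show E₁ × E₂ × ℝ from ξ).2.1 := fun ξ ↦ by
      rw [homDeriv_comp (E' := E₂ × ℝ) _ _ (contMDiff_fst_self.mdifferentiable (by simp))
        (hp₂₃.mdifferentiable (by simp)), homDeriv_fst, homDeriv_snd]
    have e₃ : ∀ ξ : GroupLieAlgebra 𝓘(ℝ, E₁ × E₂ × ℝ) (L₁ × L₂ × ℝˣ),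
        homDeriv (E₁ × E₂ × ℝ) ℝ p₃ ξ = (show E₁ × E₂ × ℝ from ξ).2.2 := fun ξ ↦ by
      rw [homDeriv_comp (E' := E₂ × ℝ) _ _ (contMDiff_snd_self.mdifferentiable (by simp))
        (hp₂₃.mdifferentiable (by simp)), homDeriv_snd, homDeriv_snd]
    let ε : ℝ →ₗ[ℝ] ℝ := (leftDₗ (E := ℝ) (fun t : ℝˣ ↦ (t : ℝ)) 1 :)
    have hε : Function.Injective ε := leftD_units_val_injective
    have e₄ : ∀ ξ : GroupLieAlgebra 𝓘(ℝ, E₁ × E₂ × ℝ) (L₁ × L₂ × ℝˣ),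
        leftD ξ ((Units.coeHom ℝ).comp p₃) 1 = ε (show E₁ × E₂ × ℝ from ξ).2.2 := fun ξ ↦ by
      have h := leftD_comp_hom p₃ hp₃ (u := fun t : ℝˣ ↦ (t : ℝ)) (g := 1)
        (Units.contMDiff_val.mdifferentiable (n := ∞) (by simp) _) ξ
      rw [map_one, e₃] at h
      exact h
    have hε' : Function.Surjective ε := LinearMap.injective_iff_surjective.1 hε
    constructor
    · intro ξ η h
      have h1 := congrArg Prod.fst h
      have h2 := congrArg (fun q ↦ q.2.1) h
      have h3 := congrArg (fun q ↦ q.2.2) h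
      exact Prod.ext (α := E₁) (β := E₂ × ℝ)
        ((homDeriv_fst ξ).symm.trans (h1.trans (homDeriv_fst η)))
        (Prod.ext ((e₂ ξ).symm.trans (h2.trans (e₂ η)))
          (hε ((e₄ ξ).symm.trans (h3.trans (e₄ η)))))
    · rintro ⟨x, y, t⟩
      obtain ⟨s, rfl⟩ := hε' t
      let ξ : GroupLieAlgebra 𝓘(ℝ, E₁ × E₂ × ℝ) (L₁ × L₂ × ℝˣ) :=
        (show E₁ × E₂ × ℝ from (x, y, s))
      exact ⟨ξ, Prod.ext (homDeriv_fst ξ) (Prod.ext (e₂ ξ) (e₄ ξ))⟩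

end TripleProduct

/-! ### Second derivatives of flat charts -/

section

variable {E : Type*} [NormedAddCommGroup E] [NormedSpace ℝ E]
  {L : Type*} [TopologicalSpace L] [ChartedSpace E L] [Group L] [LieGroup 𝓘(ℝ, E) ∞ L]

/-- The derivatives of a chart along left-invariant fields are independent. -/
theorem leftD_injective_of_openPartialHomeomorph
    {f : OpenPartialHomeomorph L E} (hf : ContMDiffOn 𝓘(ℝ, E) 𝓘(ℝ, E) ∞ f f.source)
    (hf' : ContMDiffOn 𝓘(ℝ, E) 𝓘(ℝ, E) ∞ f.symm f.target) {g : L} (hg : g ∈ f.source) :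
    Function.Injective (fun ξ : GroupLieAlgebra 𝓘(ℝ, E) L ↦ leftD ξ f g) := by
  have hfd : f.MDifferentiable 𝓘(ℝ, E) 𝓘(ℝ, E) :=
    ⟨hf.mdifferentiableOn (by simp), hf'.mdifferentiableOn (by simp)⟩
  exact fun ξ η h ↦ mulInvariantVectorField_injective g (hfd.mfderiv_injective hg h)

/-- The pullback of the standard connection by a chart `f` is characterized by the second
derivatives of `f`. -/
theorem mfderiv_pullbackConn_stdConn {f : OpenPartialHomeomorph L E}
    (hf : ContMDiffOn 𝓘(ℝ, E) 𝓘(ℝ, E) ∞ f f.source)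
    (hf' : ContMDiffOn 𝓘(ℝ, E) 𝓘(ℝ, E) ∞ f.symm f.target) {g : L} (hg : g ∈ f.source)
    {Y : Π x : L, TangentSpace 𝓘(ℝ, E) x}
    (hY : ContMDiffOn 𝓘(ℝ, E) 𝓘(ℝ, E).tangent ∞
      (fun x ↦ (⟨x, Y x⟩ : TangentBundle 𝓘(ℝ, E) L)) f.source) (v : TangentSpace 𝓘(ℝ, E) g) :
    mfderiv 𝓘(ℝ, E) 𝓘(ℝ, E) f g (pullbackConn f f.symm (stdConn E) Y g v) =
      mvfderiv 𝓘(ℝ, E) (fun x ↦ mvfderiv 𝓘(ℝ, E) f x (Y x)) g v := by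
  have hfd : f.MDifferentiable 𝓘(ℝ, E) 𝓘(ℝ, E) :=
    ⟨hf.mdifferentiableOn (by simp), hf'.mdifferentiableOn (by simp)⟩
  have hinv : (mfderiv 𝓘(ℝ, E) 𝓘(ℝ, E) f g).IsInvertible := ⟨hfd.mfderiv hg, rfl⟩
  let u : L → E := fun x ↦ mvfderiv 𝓘(ℝ, E) f x (Y x)
  have hs : ContMDiffOn 𝓘(ℝ, E) 𝓘(ℝ, E) ∞ u f.source :=
    contMDiffOn_mvfderiv_apply f.open_source hf hY
  have e : (fun z ↦ u (f.symm z)) =ᶠ[𝓝 (f g)] mpullback 𝓘(ℝ, E) 𝓘(ℝ, E) f.symm Y := by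
    filter_upwards [f.open_target.mem_nhds (f.map_source hg)] with z hz
    rw [mpullback_symm_apply hfd _ hz]
    rfl
  have hu : DifferentiableAt ℝ (fun z ↦ u (f.symm z)) (f g) := by
    have : ContMDiffOn 𝓘(ℝ, E) 𝓘(ℝ, E) ∞ (fun z ↦ u (f.symm z)) f.target :=
      hs.comp hf' f.symm.mapsTo
    exact (mdifferentiableAt_of_contMDiffOn f.open_target (f.map_source hg) this).differentiableAt
  have h1 : stdConn E (mpullback 𝓘(ℝ, E) 𝓘(ℝ, E) f.symm Y) (f g) =
    fderiv ℝ (fun z ↦ u (f.symm z)) (f g) := e.symm.fderiv_eq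
  have h2 : (fun x ↦ u (f.symm (f x))) =ᶠ[𝓝 g] u := by
    filter_upwards [f.open_source.mem_nhds hg] with x hx
    simp only [f.left_inv hx]
  have h3 := mvfderiv_comp_vector (u := fun z ↦ u (f.symm z)) (f := f) g hu.mdifferentiableAt
    (hfd.mdifferentiableAt hg) v
  rw [mvfderiv_eq_fderiv] at h3
  simp only [pullbackConn, ContinuousLinearMap.comp_apply]
  rw [hinv.self_apply_inverse, h1, ← mvfderiv_congr h2]
  exact h3.symm

end

section HessianOfChart

variable {E : Type*} [NormedAddCommGroup E] [NormedSpace ℝ E] [FiniteDimensional ℝ E]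
  {L : Type*} [TopologicalSpace L] [ChartedSpace E L] [Group L] [LieGroup 𝓘(ℝ, E) ∞ L]

theorem isInvertible_mfderiv_mul_left (g h : L) :
    (mfderiv 𝓘(ℝ, E) 𝓘(ℝ, E) (fun x : L ↦ g * x) h).IsInvertible := by
  have hi : Function.Injective
      (mfderiv 𝓘(ℝ, E) 𝓘(ℝ, E) (fun x : L ↦ g * x) h : E →L[ℝ] E) := by
    rw [injective_iff_map_eq_zero]
    intro v hv
    obtain ⟨ξ, rfl⟩ := (leftTriv h).surjective v
    rw [leftTriv_apply] at hv ⊢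
    have h1 := (mfderiv_mul_left_mulInvariantVectorField g h ξ).symm.trans hv
    have h2 : ξ = 0 := (leftTriv (E := E) (g * h)).injective (by rw [map_zero]; exact h1)
    rw [h2]; exact map_zero (leftTriv (E := E) h)
  let A : E →ₗ[ℝ] E := (mfderiv 𝓘(ℝ, E) 𝓘(ℝ, E) (fun x : L ↦ g * x) h : E →L[ℝ] E).toLinearMap
  exact ⟨(LinearEquiv.ofInjectiveEndo A hi).toContinuousLinearEquiv, by ext; rfl⟩

/-- The Christoffel symbols of a connection with respect to left-invariant vector fields, taken at
the identity: `christoffel D ξ η` is the covariant derivative of the field of `η` along `ξ`. -/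
def christoffel (D : CovariantDerivative 𝓘(ℝ, E) E (TangentSpace 𝓘(ℝ, E) : L → Type _)) :
    GroupLieAlgebra 𝓘(ℝ, E) L →ₗ[ℝ] GroupLieAlgebra 𝓘(ℝ, E) L →ₗ[ℝ]
      GroupLieAlgebra 𝓘(ℝ, E) L :=
  LinearMap.mk₂ ℝ (fun ξ η ↦ D (mulInvariantVectorField η) (1 : L) ξ)
    (fun _ _ _ ↦ map_add _ _ _) (fun _ _ _ ↦ map_smul _ _ _)
    (fun ξ η η' ↦ by
      rw [mulInvariantVectorField_add]
      rw [D.isCovariantDerivativeOnUniv.add (mdifferentiableAt_mulInvariantVectorField_infty _ _)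
        (mdifferentiableAt_mulInvariantVectorField_infty _ _) (mem_univ _)]
      rfl)
    (fun c ξ η ↦ by
      rw [mulInvariantVectorField_smul]
      rw [D.isCovariantDerivativeOnUniv.smul_const _
        (mdifferentiableAt_mulInvariantVectorField_infty _ _) (mem_univ _)]
      rfl)

/-- If left translation by `g` preserves the projective class of a connection, then the values of the
connection on left-invariant fields at `g` are the translates of those at `1`, up to a term of
projective type. -/
theorem exists_covariantDerivative_mulInvariant
    {D : CovariantDerivative 𝓘(ℝ, E) E (TangentSpace 𝓘(ℝ, E) : L → Type _)} {g : L}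
    (h : ProjEquivOn univ (pullbackConn (fun x : L ↦ g * x) (fun x : L ↦ g⁻¹ * x) D) D) :
    ∃ θ : GroupLieAlgebra 𝓘(ℝ, E) L →ₗ[ℝ] ℝ, ∀ ξ η : GroupLieAlgebra 𝓘(ℝ, E) L,
      D (mulInvariantVectorField η) g (mulInvariantVectorField ξ g) =
        mulInvariantVectorField (christoffel D ξ η + θ ξ • η + θ η • ξ) g := by
  obtain ⟨φ, -, hφ⟩ := h
  refine ⟨(φ 1 : E →L[ℝ] ℝ).toLinearMap, fun ξ η ↦ ?_⟩
  have h1 := hφ _ _ (contMDiff_mulInvariantVectorField_infty ξ).contMDiffOn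
    (contMDiff_mulInvariantVectorField_infty η).contMDiffOn 1 (mem_univ _)
  simp only [pullbackConn, mpullback_mulInvariantVectorField,
    ContinuousLinearMap.comp_apply] at h1
  rw [mfderiv_mul_left_mulInvariantVectorField] at h1
  rw [sub_eq_iff_eq_add] at h1
  have h2 := congrArg (mfderiv 𝓘(ℝ, E) 𝓘(ℝ, E) (fun x : L ↦ g * x) 1) h1
  rw [(isInvertible_mfderiv_mul_left g 1).self_apply_inverse, map_add, map_add, map_smul, map_smul,
    mfderiv_mul_left_mulInvariantVectorField, mfderiv_mul_left_mulInvariantVectorField] at h2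
  have h3 : mfderiv 𝓘(ℝ, E) 𝓘(ℝ, E) (fun x : L ↦ g * x) 1
      (D (mulInvariantVectorField η) 1 (mulInvariantVectorField ξ 1)) =
      mulInvariantVectorField (christoffel D ξ η) (g * 1) := by
    rw [← mfderiv_mul_left_mulInvariantVectorField, mulInvariantVectorField_one,
      mulInvariantVectorField_one]
    rfl
  have h4 : ∀ y : L, y = g → ∀ a b : ℝ,
      D (mulInvariantVectorField η) y (mulInvariantVectorField ξ y) =
        (a • mulInvariantVectorField η y + b • mulInvariantVectorField ξ y) +
          mulInvariantVectorField (christoffel D ξ η) y →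
      D (mulInvariantVectorField η) g (mulInvariantVectorField ξ g) =
        mulInvariantVectorField (christoffel D ξ η + a • η + b • ξ) g := by
    rintro _ rfl a b h
    simp only [mulInvariantVectorField_add, mulInvariantVectorField_smul, Pi.add_apply,
      Pi.smul_apply]
    rw [h]; abel
  rw [h3] at h2
  have h5 := h4 (g * 1) (mul_one g) _ _ h2
  rw [mulInvariantVectorField_one, mulInvariantVectorField_one] at h5
  exact h5

/-- A flat chart of a left-invariant projective structure has second derivatives along
left-invariant fields which are, up to terms of projective type, given by constant coefficients. -/
theorem exists_leftD_leftD_eq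
    {D : CovariantDerivative 𝓘(ℝ, E) E (TangentSpace 𝓘(ℝ, E) : L → Type _)} {g : L}
    (h : ProjEquivOn univ (pullbackConn (fun x : L ↦ g * x) (fun x : L ↦ g⁻¹ * x) D) D)
    {f : OpenPartialHomeomorph L E} (hf : ContMDiffOn 𝓘(ℝ, E) 𝓘(ℝ, E) ∞ f f.source)
    (hf' : ContMDiffOn 𝓘(ℝ, E) 𝓘(ℝ, E) ∞ f.symm f.target)
    (hD : ProjEquivOn f.source (pullbackConn f f.symm (stdConn E)) D) (hg : g ∈ f.source) :
    ∃ θ : GroupLieAlgebra 𝓘(ℝ, E) L →ₗ[ℝ] ℝ, ∀ ξ η : GroupLieAlgebra 𝓘(ℝ, E) L,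
      leftD ξ (leftD η f) g =
        leftD (christoffel D ξ η) f g + θ ξ • leftD η f g + θ η • leftD ξ f g := by
  obtain ⟨θ, hθ⟩ := exists_covariantDerivative_mulInvariant h
  obtain ⟨φ, -, hφ⟩ := hD
  refine ⟨θ + ((φ g : E →L[ℝ] ℝ).toLinearMap.comp (leftTriv (E := E) g).toLinearMap), fun ξ η ↦ ?_⟩
  have h1 := hφ _ _ (contMDiff_mulInvariantVectorField_infty ξ).contMDiffOn
    (contMDiff_mulInvariantVectorField_infty η).contMDiffOn g hg
  rw [sub_eq_iff_eq_add, hθ] at h1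
  have h2 := congrArg (mfderiv 𝓘(ℝ, E) 𝓘(ℝ, E) f g) h1
  rw [mfderiv_pullbackConn_stdConn hf hf' hg
    (contMDiff_mulInvariantVectorField_infty η).contMDiffOn] at h2
  refine h2.trans ?_
  have h5 : ∀ (a b : ℝ), mfderiv 𝓘(ℝ, E) 𝓘(ℝ, E) f g
      (a • mulInvariantVectorField η g + b • mulInvariantVectorField ξ g +
        mulInvariantVectorField (christoffel D ξ η + θ ξ • η + θ η • ξ) g) =
      leftD (christoffel D ξ η) f g + (θ ξ + a) • leftD η f g + (θ η + b) • leftD ξ f g := by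
    intro a b
    have : (mfderiv 𝓘(ℝ, E) 𝓘(ℝ, E) f g
      (a • mulInvariantVectorField η g + b • mulInvariantVectorField ξ g +
        mulInvariantVectorField (christoffel D ξ η + θ ξ • η + θ η • ξ) g) : E) =
      a • leftD η f g + b • leftD ξ f g + leftD (christoffel D ξ η + θ ξ • η + θ η • ξ) f g := by
      rw [map_add, map_add, map_smul, map_smul]; rfl
    rw [this, leftD_add_left, leftD_add_left, leftD_smul_left, leftD_smul_left]
    have : ∀ (p q r : E) (s t : ℝ), a • q + b • r + (p + s • q + t • r) =
      p + (s + a) • q + (t + b) • r := by intros; module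
    exact this _ _ _ _ _
  exact h5 _ _

end HessianOfChart

/-! ### The derivative of the determinant -/

section DerivativeOfDeterminant

variable {E : Type*} [NormedAddCommGroup E] [NormedSpace ℝ E] [FiniteDimensional ℝ E]
  {ι : Type*} [Fintype ι] [DecidableEq ι]

theorem contDiff_basis_det (e : Module.Basis ι ℝ E) : ContDiff ℝ ∞ (fun v : ι → E ↦ e.det v) := by
  simp only [Module.Basis.det_apply, Matrix.det_apply, Module.Basis.toMatrix_apply]
  refine ContDiff.sum fun σ _ ↦ ContDiff.const_smul _ (contDiff_prod fun i _ ↦ ?_)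
  exact (LinearMap.toContinuousLinearMap (e.coord (σ i))).contDiff.comp (contDiff_apply ℝ E i)

/-- Jacobi's formula for the derivative of the determinant at `A` in the direction `A ∘ T`. -/
theorem fderiv_basis_det (e : Module.Basis ι ℝ E) (A T : E →ₗ[ℝ] E) :
    fderiv ℝ (fun v : ι → E ↦ e.det v) (fun j ↦ A (e j)) (fun j ↦ A (T (e j))) =
      LinearMap.trace ℝ E T * e.det (fun j ↦ A (e j)) := by
  have h1 : HasDerivAt (fun t : ℝ ↦ e.det ((fun j ↦ A (e j)) + t • fun j ↦ A (T (e j))))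
      (fderiv ℝ (fun v : ι → E ↦ e.det v) (fun j ↦ A (e j)) (fun j ↦ A (T (e j)))) 0 := by
    have h := ((contDiff_basis_det e).differentiable (by simp) (fun j ↦ A (e j))).hasFDerivAt
    have hl : HasDerivAt (fun t : ℝ ↦ (fun j ↦ A (e j)) + t • fun j ↦ A (T (e j)))
      (fun j ↦ A (T (e j))) 0 := by
      simpa using ((hasDerivAt_id (0 : ℝ)).smul_const (fun j ↦ A (T (e j)))).const_add
        (fun j ↦ A (e j))
    refine HasFDerivAt.comp_hasDerivAt
      (f := fun t : ℝ ↦ (fun j ↦ A (e j)) + t • fun j ↦ A (T (e j))) (0 : ℝ) ?_ hl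
    simpa using h
  have h2 : (fun t : ℝ ↦ e.det ((fun j ↦ A (e j)) + t • fun j ↦ A (T (e j)))) =
      fun t : ℝ ↦ e.det (fun j ↦ A (e j)) * (1 + t • LinearMap.toMatrix e e T).det := by
    funext t
    have e1 : ((fun j ↦ A (e j)) + t • fun j ↦ A (T (e j))) =
      (A ∘ₗ (1 + t • T)) ∘ e := by ext j; simp
    have e2 : (fun j ↦ A (e j)) = A ∘ e := rfl
    rw [e1, e2, Module.Basis.det_comp, Module.Basis.det_comp, LinearMap.det_comp,
      ← LinearMap.det_toMatrix e (1 + t • T)]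
    simp [LinearMap.toMatrix_one]
    ring
  rw [h2] at h1
  refine h1.unique ?_
  rw [LinearMap.trace_eq_matrix_trace ℝ e]
  generalize LinearMap.toMatrix e e T = M
  obtain ⟨P, hP⟩ : ∃ P : Polynomial ℝ, ∀ t : ℝ,
      (1 + t • M).det = 1 + M.trace * t + P.eval t * t ^ 2 :=
    ⟨_, fun t ↦ Matrix.det_one_add_smul t M⟩
  simp only [hP]
  have h3 : HasDerivAt (fun t : ℝ ↦ 1 + M.trace * t + P.eval t * t ^ 2) M.trace 0 := by
    have := (((hasDerivAt_id (0 : ℝ)).const_mul M.trace).const_add 1).add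
      ((P.hasDerivAt 0).mul ((hasDerivAt_id (0 : ℝ)).pow 2))
    refine this.congr_deriv ?_
    simp
  exact (h3.const_mul _).congr_deriv (mul_comm _ _)

end DerivativeOfDeterminant

/-! ### From projective structures to homogeneous lifts -/

section Lifting

variable {E : Type*} [NormedAddCommGroup E] [NormedSpace ℝ E] [FiniteDimensional ℝ E]
  {L : Type*} [TopologicalSpace L] [ChartedSpace E L] [Group L] [LieGroup 𝓘(ℝ, E) ∞ L]
  {U : Set L} {f : L → E} {Γ : GroupLieAlgebra 𝓘(ℝ, E) L →ₗ[ℝ] GroupLieAlgebra 𝓘(ℝ, E) L →ₗ[ℝ]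
    GroupLieAlgebra 𝓘(ℝ, E) L}

/-- The one-form in the second derivatives of a flat chart is, up to a left-invariant term, the
logarithmic derivative of a function, namely of a power of the Jacobian determinant of the chart
with respect to a left-invariant frame. -/
theorem exists_leftD_eq_neg_mul (hU : IsOpen U) (hf : ContMDiffOn 𝓘(ℝ, E) 𝓘(ℝ, E) ∞ f U)
    (hinj : ∀ g ∈ U, Function.Injective (fun ξ : GroupLieAlgebra 𝓘(ℝ, E) L ↦ leftD ξ f g))
    {θ : L → GroupLieAlgebra 𝓘(ℝ, E) L →ₗ[ℝ] ℝ}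
    (hsecond : ∀ g ∈ U, ∀ ξ η : GroupLieAlgebra 𝓘(ℝ, E) L,
      leftD ξ (leftD η f) g = leftD (Γ ξ η) f g + θ g ξ • leftD η f g + θ g η • leftD ξ f g) :
    ∃ (l : L → ℝ) (τ : GroupLieAlgebra 𝓘(ℝ, E) L →ₗ[ℝ] ℝ),
      ContMDiffOn 𝓘(ℝ, E) 𝓘(ℝ, ℝ) ∞ l U ∧ (∀ g, 0 < l g) ∧
      ∀ g ∈ U, ∀ ξ : GroupLieAlgebra 𝓘(ℝ, E) L, leftD ξ l g = -(l g * (τ ξ + θ g ξ)) := by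
  let e : Module.Basis (Fin (Module.finrank ℝ E)) ℝ E := Module.finBasis ℝ E
  let n : ℝ := (Module.finrank ℝ E : ℕ)
  have hn1 : n + 1 ≠ 0 := by positivity
  let frame : L → Fin (Module.finrank ℝ E) → E := fun g j ↦
    leftD (show GroupLieAlgebra 𝓘(ℝ, E) L from e j) f g
  have hframe : ContMDiffOn 𝓘(ℝ, E) 𝓘(ℝ, Fin (Module.finrank ℝ E) → E) ∞ frame U :=
    contMDiffOn_pi_space.2 fun j ↦ contMDiffOn_leftD hU hf _
  let A : L → E →ₗ[ℝ] E := fun g ↦ leftDₗ (E := E) f g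
  have hA : ∀ g, frame g = fun j ↦ A g (e j) := fun g ↦ rfl
  let Δ : L → ℝ := fun g ↦ e.det (frame g)
  have hΔ0 : ∀ g ∈ U, Δ g ≠ 0 := fun g hg ↦ by
    have hi : Function.Injective (A g) := hinj g hg
    have h1 : Δ g = LinearMap.det (A g) * e.det e := Module.Basis.det_comp e (A g) e
    rw [h1, e.det_self, mul_one]
    exact ((LinearMap.isUnit_iff_isUnit_det _).1
      ((Module.End.isUnit_iff _).2 ⟨hi, LinearMap.injective_iff_surjective.1 hi⟩)).ne_zero
  have hΔs : ContMDiffOn 𝓘(ℝ, E) 𝓘(ℝ, ℝ) ∞ Δ U :=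
    (contDiff_basis_det e).contMDiff.comp_contMDiffOn hframe
  have hΔ : ∀ g ∈ U, ∀ ξ : GroupLieAlgebra 𝓘(ℝ, E) L,
      leftD ξ Δ g = (LinearMap.trace ℝ _ (Γ ξ) + (n + 1) * θ g ξ) * Δ g := by
    intro g hg ξ
    have hfr := mdifferentiableAt_of_contMDiffOn hU hg hframe
    have h1 : leftD ξ Δ g = fderiv ℝ (fun v ↦ e.det v) (frame g) (leftD ξ frame g) :=
      leftD_comp (f := fun v ↦ e.det v) ((contDiff_basis_det e).differentiable (by simp) _) hfr
    let G : E →ₗ[ℝ] E := Γ ξ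
    let t : E →ₗ[ℝ] ℝ := θ g
    let x : E := ξ
    -- the derivative of the frame along `ξ` is the frame composed with `T`
    let T : E →ₗ[ℝ] E := G + t x • LinearMap.id + t.smulRight x
    have h2 : leftD ξ frame g = fun j ↦ A g (T (e j)) := by
      funext j
      have h3 := leftD_clm (ξ := ξ) (ContinuousLinearMap.proj (R := ℝ) (φ := fun _ ↦ E) j) hfr
      have h4 : A g (T (e j)) = A g (G (e j)) + t x • A g (e j) + t (e j) • A g x := by
        simp only [T, LinearMap.add_apply, LinearMap.smul_apply, LinearMap.id_apply,
          LinearMap.smulRight_apply, map_add, map_smul]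
      exact h3.symm.trans ((hsecond g hg ξ (e j)).trans h4.symm)
    have h5 : LinearMap.trace ℝ E T = LinearMap.trace ℝ E G + (n + 1) * t x := by
      simp only [T, map_add, map_smul, LinearMap.trace_id, LinearMap.trace_smulRight, smul_eq_mul]
      ring
    rw [h1, h2, hA, fderiv_basis_det, h5]
    rfl
  -- the power `|Δ| ^ (-1 / (n + 1))`; `Real.log` is the logarithm of the absolute value, so the sign
  -- of `Δ` does not matter
  refine ⟨fun g ↦ Real.exp (-(n + 1)⁻¹ * Real.log (Δ g)),
    (n + 1)⁻¹ • (LinearMap.trace ℝ (GroupLieAlgebra 𝓘(ℝ, E) L)).comp Γ, ?_,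
    fun g ↦ Real.exp_pos _, fun g hg ξ ↦ ?_⟩
  · intro g hg
    have h1 : ContDiffAt ℝ ∞ (fun t : ℝ ↦ Real.exp (-(n + 1)⁻¹ * Real.log t)) (Δ g) :=
      (contDiffAt_const.mul (Real.contDiffAt_log.2 (hΔ0 g hg))).exp
    exact ContMDiffAt.comp_contMDiffWithinAt (f := Δ) g h1.contMDiffAt (hΔs g hg)
  · have h1 : HasDerivAt (fun t : ℝ ↦ Real.exp (-(n + 1)⁻¹ * Real.log t))
        (Real.exp (-(n + 1)⁻¹ * Real.log (Δ g)) * (-(n + 1)⁻¹ * (Δ g)⁻¹)) (Δ g) :=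
      ((Real.hasDerivAt_log (hΔ0 g hg)).const_mul _).exp
    rw [leftD_comp (f := fun t : ℝ ↦ Real.exp (-(n + 1)⁻¹ * Real.log t)) (u := Δ)
      h1.differentiableAt (mdifferentiableAt_of_contMDiffOn hU hg hΔs), hΔ g hg,
      h1.hasFDerivAt.fderiv]
    simp only [ContinuousLinearMap.toSpanSingleton_apply, smul_eq_mul, LinearMap.smul_apply,
      LinearMap.comp_apply]
    have := hΔ0 g hg
    field_simp

/-- If the second derivatives of `F` along left-invariant fields are combinations of first
derivatives, with constant coefficients, and of `F` itself, then the coefficients of `F` are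
constant too, provided that the dimension is at least two. -/
theorem leftD_coefficient_const (hn : 2 ≤ Module.finrank ℝ E)
    {V : Type*} [NormedAddCommGroup V] [NormedSpace ℝ V] {F : L → V}
    (hU : IsOpen U) (hF : ContMDiffOn 𝓘(ℝ, E) 𝓘(ℝ, V) ∞ F U)
    (hind : ∀ g ∈ U, ∀ (ξ : GroupLieAlgebra 𝓘(ℝ, E) L) (c : ℝ),
      leftD ξ F g + c • F g = 0 → ξ = 0)
    {N : GroupLieAlgebra 𝓘(ℝ, E) L → GroupLieAlgebra 𝓘(ℝ, E) L → L → ℝ}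
    (hN : ∀ ξ η, ContMDiffOn 𝓘(ℝ, E) 𝓘(ℝ, ℝ) ∞ (N ξ η) U)
    (hN0 : ∀ η g, N 0 η g = 0)
    (hsecond : ∀ g ∈ U, ∀ ξ η : GroupLieAlgebra 𝓘(ℝ, E) L,
      leftD ξ (leftD η F) g = leftD (Γ ξ η) F g + N ξ η g • F g)
    {g h : L} (hg : g ∈ U) (hh : h ∈ U) (ξ η : GroupLieAlgebra 𝓘(ℝ, E) L) :
    N ξ η g = N ξ η h := by
  -- compare the two orders of differentiation in a third derivative
  have key : ∀ g ∈ U, ∀ ζ ξ η : GroupLieAlgebra 𝓘(ℝ, E) L,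
      N ξ η g • ζ - N ζ η g • ξ = Γ ⁅ζ, ξ⁆ η - Γ ζ (Γ ξ η) + Γ ξ (Γ ζ η) := by
    intro g hg ζ ξ η
    have dF := mdifferentiableAt_of_contMDiffOn hU hg hF
    have third : ∀ ζ ξ : GroupLieAlgebra 𝓘(ℝ, E) L, leftD ζ (leftD ξ (leftD η F)) g =
        leftD (Γ ζ (Γ ξ η) + N ξ η g • ζ) F g +
          (N ζ (Γ ξ η) g + leftD ζ (N ξ η) g) • F g := by
      intro ζ ξ
      have dN := mdifferentiableAt_of_contMDiffOn hU hg (hN ξ η)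
      rw [leftD_congr_of_isOpen (v := fun x ↦ leftD (Γ ξ η) F x + N ξ η x • F x) hU hg
        fun x hx ↦ hsecond x hx ξ η,
        leftD_add (mdifferentiableAt_of_contMDiffOn hU hg (contMDiffOn_leftD hU hF _))
          (mdifferentiableAt_fun_smul dN dF), hsecond g hg, leftD_smul dN dF, leftD_add_left,
        leftD_smul_left]
      module
    have h1 := leftD_leftD_sub (ξ := ζ) (η := ξ) hU hg (contMDiffOn_leftD hU hF η)
    rw [third, third, hsecond g hg] at h1
    have h2 := hind g hg
      ((Γ ζ (Γ ξ η) + N ξ η g • ζ) - (Γ ξ (Γ ζ η) + N ζ η g • ξ) - Γ ⁅ζ, ξ⁆ η)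
      ((N ζ (Γ ξ η) g + leftD ζ (N ξ η) g) - (N ξ (Γ ζ η) g + leftD ξ (N ζ η) g) -
        N ⁅ζ, ξ⁆ η g) (by
        rw [leftD_sub_left, leftD_sub_left, sub_smul, sub_smul]
        rw [sub_eq_iff_eq_add] at h1
        rw [eq_sub_of_add_eq h1]
        abel)
    have h3 : N ξ η g • ζ - N ζ η g • ξ - (Γ ⁅ζ, ξ⁆ η - Γ ζ (Γ ξ η) + Γ ξ (Γ ζ η)) = 0 := by
      rw [← h2]; abel
    exact sub_eq_zero.1 h3
  rcases eq_or_ne ξ 0 with rfl | hξ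
  · rw [hN0, hN0]
  obtain ⟨ζ, hζ⟩ : ∃ ζ : GroupLieAlgebra 𝓘(ℝ, E) L, LinearIndependent ℝ ![ξ, ζ] :=
    exists_linearIndependent_pair_of_one_lt_finrank (R := ℝ) hn hξ
  -- a direction independent of `ξ` separates the two coefficients
  have h1 := (key g hg ζ ξ η).trans (key h hh ζ ξ η).symm
  have h2 : (N ζ η h - N ζ η g) • ξ + (N ξ η g - N ξ η h) • ζ = 0 := by
    rw [sub_smul, sub_smul, ← sub_eq_zero.2 h1]; abel
  exact sub_eq_zero.1 (LinearIndependent.pair_iff.1 hζ _ _ h2).2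

/-- The graph of a flat chart, suitably rescaled, is a homogeneous lift. -/
theorem hasHomogeneousLift_of_leftD_leftD_eq {E L : Type} [NormedAddCommGroup E] [NormedSpace ℝ E]
    [FiniteDimensional ℝ E] [TopologicalSpace L] [ChartedSpace E L] [Group L]
    [LieGroup 𝓘(ℝ, E) ∞ L] {U : Set L} {f : L → E}
    {Γ : GroupLieAlgebra 𝓘(ℝ, E) L →ₗ[ℝ] GroupLieAlgebra 𝓘(ℝ, E) L →ₗ[ℝ]
      GroupLieAlgebra 𝓘(ℝ, E) L} (hn : 2 ≤ Module.finrank ℝ E) (hU : IsOpen U)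
    (h1 : 1 ∈ U) (hf : ContMDiffOn 𝓘(ℝ, E) 𝓘(ℝ, E) ∞ f U)
    (hinj : ∀ g ∈ U, Function.Injective (fun ξ : GroupLieAlgebra 𝓘(ℝ, E) L ↦ leftD ξ f g))
    {θ : L → GroupLieAlgebra 𝓘(ℝ, E) L →ₗ[ℝ] ℝ}
    (hsecond : ∀ g ∈ U, ∀ ξ η : GroupLieAlgebra 𝓘(ℝ, E) L,
      leftD ξ (leftD η f) g = leftD (Γ ξ η) f g + θ g ξ • leftD η f g + θ g η • leftD ξ f g) :
    HasHomogeneousLift E L := by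
  obtain ⟨l, τ, hl, hl0, hθ⟩ := exists_leftD_eq_neg_mul hU hf hinj hsecond
  -- the left-invariant part of `θ` goes into the first-order coefficients
  let B : GroupLieAlgebra 𝓘(ℝ, E) L →ₗ[ℝ] GroupLieAlgebra 𝓘(ℝ, E) L →ₗ[ℝ]
      GroupLieAlgebra 𝓘(ℝ, E) L :=
    Γ - LinearMap.mk₂ ℝ (fun ξ η ↦ τ ξ • η + τ η • ξ) (fun _ _ _ ↦ by rw [map_add]; module)
      (fun _ _ _ ↦ by rw [map_smul, smul_eq_mul]; module)
      (fun _ _ _ ↦ by rw [map_add]; module) (fun _ _ _ ↦ by rw [map_smul, smul_eq_mul]; module)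
  have hB : ∀ ξ η, B ξ η = Γ ξ η - (τ ξ • η + τ η • ξ) := fun ξ η ↦ rfl
  have hl0' : ∀ g, l g ≠ 0 := fun g ↦ (hl0 g).ne'
  have hsec : ∀ g ∈ U, ∀ ξ η : GroupLieAlgebra 𝓘(ℝ, E) L,
      l g • leftD ξ (leftD η f) g + leftD ξ l g • leftD η f g + leftD η l g • leftD ξ f g =
        l g • leftD (B ξ η) f g := by
    intro g hg ξ η
    rw [hsecond g hg, hθ g hg, hθ g hg, hB, leftD_sub_left, leftD_add_left, leftD_smul_left,
      leftD_smul_left]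
    module
  let F : L → E × ℝ := fun x ↦ (l x • f x, l x)
  have hF : ContMDiffOn 𝓘(ℝ, E) 𝓘(ℝ, E × ℝ) ∞ F U := (hl.smul hf).prodMk_space hl
  have hfirst : ∀ g ∈ U, ∀ ξ : GroupLieAlgebra 𝓘(ℝ, E) L,
      leftD ξ F g = (l g • leftD ξ f g + leftD ξ l g • f g, leftD ξ l g) := by
    intro g hg ξ
    have dl := mdifferentiableAt_of_contMDiffOn hU hg hl
    have df := mdifferentiableAt_of_contMDiffOn hU hg hf
    rw [leftD_prodMk (mdifferentiableAt_fun_smul dl df) dl, leftD_smul dl df]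
  have hind : ∀ g ∈ U, ∀ (ξ : GroupLieAlgebra 𝓘(ℝ, E) L) (c : ℝ),
      leftD ξ F g + c • F g = 0 → ξ = 0 ∧ c = 0 := by
    intro g hg ξ c h
    rw [hfirst g hg] at h
    simp only [F, Prod.smul_mk, Prod.mk_add_mk, Prod.mk_eq_zero] at h
    obtain ⟨h3, h4⟩ := h
    have h5 : l g • leftD ξ f g = 0 := by
      have : l g • leftD ξ f g = (l g • leftD ξ f g + leftD ξ l g • f g + c • l g • f g) -
        (leftD ξ l g + c • l g) • f g := by rw [smul_eq_mul]; module
      rw [this, h3, h4, zero_smul, sub_zero]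
    have h6 : ξ = 0 := hinj g hg <| by
      simpa only [leftD_zero_left] using (smul_eq_zero.1 h5).resolve_left (hl0' g)
    refine ⟨h6, ?_⟩
    rw [h6, leftD_zero_left, zero_add] at h4
    exact (smul_eq_zero.1 h4).resolve_right (hl0' g)
  let N : GroupLieAlgebra 𝓘(ℝ, E) L → GroupLieAlgebra 𝓘(ℝ, E) L → L → ℝ := fun ξ η g ↦
    (l g)⁻¹ * (leftD ξ (leftD η l) g - leftD (B ξ η) l g)
  have hN : ∀ ξ η, ContMDiffOn 𝓘(ℝ, E) 𝓘(ℝ, ℝ) ∞ (N ξ η) U := fun ξ η ↦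
    (hl.inv₀ fun g _ ↦ hl0' g).mul
      ((contMDiffOn_leftD hU (contMDiffOn_leftD hU hl η) ξ).sub (contMDiffOn_leftD hU hl _))
  have hsecF : ∀ g ∈ U, ∀ ξ η : GroupLieAlgebra 𝓘(ℝ, E) L,
      leftD ξ (leftD η F) g = leftD (B ξ η) F g + N ξ η g • F g := by
    intro g hg ξ η
    have dl := mdifferentiableAt_of_contMDiffOn hU hg hl
    have df := mdifferentiableAt_of_contMDiffOn hU hg hf
    have dl' := mdifferentiableAt_of_contMDiffOn hU hg (contMDiffOn_leftD hU hl η)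
    have df' := mdifferentiableAt_of_contMDiffOn hU hg (contMDiffOn_leftD hU hf η)
    have d1 := mdifferentiableAt_fun_smul dl df'
    have d2 := mdifferentiableAt_fun_smul dl' df
    have d3 : MDifferentiableAt 𝓘(ℝ, E) 𝓘(ℝ, E)
      (fun x ↦ l x • leftD η f x + leftD η l x • f x) g := d1.add d2
    rw [leftD_congr_of_isOpen hU hg fun x hx ↦ hfirst x hx η, leftD_prodMk d3 dl',
      leftD_add d1 d2, leftD_smul dl df', leftD_smul dl' df, hfirst g hg]
    have e1 : N ξ η g * l g = leftD ξ (leftD η l) g - leftD (B ξ η) l g := by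
      simp only [N]; field_simp [hl0' g]
    simp only [F, Prod.smul_mk, Prod.mk_add_mk]
    refine Prod.ext ?_ ?_
    · dsimp only
      rw [smul_smul, e1, ← hsec g hg]; module
    · dsimp only
      rw [smul_eq_mul, e1]; ring
  refine ⟨E × ℝ, inferInstance, inferInstance, inferInstance, U, F, hU, h1, hF, fun ξ η ↦
    ⟨B ξ η, N ξ η 1, fun g hg ↦ ?_⟩, by simp, hind 1 h1⟩
  rw [hsecF g hg, leftD_coefficient_const hn hU hF (fun g hg ξ c h ↦ (hind g hg ξ c h).1) hN
    (fun η g ↦ by simp [N, leftD_zero_left]) hsecF hg h1 ξ η]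

theorem LieGroupAdmitsIFPS.hasHomogeneousLift {E L : Type} [NormedAddCommGroup E] [NormedSpace ℝ E]
    [FiniteDimensional ℝ E] [TopologicalSpace L] [ChartedSpace E L] [Group L]
    [LieGroup 𝓘(ℝ, E) ∞ L] (hn : 2 ≤ Module.finrank ℝ E) (h : LieGroupAdmitsIFPS E L) :
    HasHomogeneousLift E L := by
  obtain ⟨D, hD⟩ := h
  obtain ⟨f, h1, hf, hf', hfl⟩ := hD.flat 1
  have key : ∀ g : L, ∃ θ : GroupLieAlgebra 𝓘(ℝ, E) L →ₗ[ℝ] ℝ, g ∈ f.source → ∀ ξ η,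
      leftD ξ (leftD η f) g =
        leftD (christoffel D ξ η) f g + θ ξ • leftD η f g + θ η • leftD ξ f g := by
    intro g
    by_cases hg : g ∈ f.source
    · obtain ⟨θ, hθ⟩ := exists_leftD_leftD_eq (hD.left_invariant g) hf hf' hfl hg
      exact ⟨θ, fun _ ↦ hθ⟩
    · exact ⟨0, fun h ↦ absurd h hg⟩
  choose θ hθ using key
  exact hasHomogeneousLift_of_leftD_leftD_eq hn f.open_source h1 hf
    (fun g hg ↦ leftD_injective_of_openPartialHomeomorph hf hf' hg) hθ

end Lifting

/-! ### Smoothness in the left trivialization of the tangent bundle -/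

section FiniteDimensionalOperators

variable {E : Type*} [NormedAddCommGroup E] [NormedSpace ℝ E]
  {M : Type*} [TopologicalSpace M] [ChartedSpace E M]
  {W : Type*} [NormedAddCommGroup W] [NormedSpace ℝ W] [FiniteDimensional ℝ W]
  {V : Type*} [NormedAddCommGroup V] [NormedSpace ℝ V]

/-- A family of linear maps on a finite-dimensional space is smooth if it is so pointwise. -/
theorem contMDiffAt_clm_of_apply {C : M → W →L[ℝ] V} {p : M}
    (h : ∀ w, ContMDiffAt 𝓘(ℝ, E) 𝓘(ℝ, V) ∞ (fun g ↦ C g w) p) :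
    ContMDiffAt 𝓘(ℝ, E) 𝓘(ℝ, W →L[ℝ] V) ∞ C p := by
  let e := Module.finBasis ℝ W
  let c : Fin (Module.finrank ℝ W) → V →L[ℝ] W →L[ℝ] V := fun j ↦
    ContinuousLinearMap.smulRightL ℝ W V (LinearMap.toContinuousLinearMap (e.coord j))
  have h1 : C = fun g ↦ ∑ j, c j (C g (e j)) := by
    funext g
    ext w
    conv_lhs => rw [← e.sum_repr w, map_sum]
    simp [c]
  rw [h1]
  exact ContMDiffAt.sum fun j _ ↦ (c j).contMDiff.contMDiffAt.comp p (h (e j))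

end FiniteDimensionalOperators

section

variable {E : Type*} [NormedAddCommGroup E] [NormedSpace ℝ E]
  {L : Type*} [TopologicalSpace L] [ChartedSpace E L] [IsManifold 𝓘(ℝ, E) 1 L]

theorem baseSet_mem_nhds (p : L) :
    (trivializationAt E (TangentSpace 𝓘(ℝ, E) : L → Type _) p).baseSet ∈ 𝓝 p :=
  (trivializationAt E (TangentSpace 𝓘(ℝ, E) : L → Type _) p).open_baseSet.mem_nhds
    (mem_baseSet_trivializationAt E _ p)

end

section LeftFrame

variable {E : Type*} [NormedAddCommGroup E] [NormedSpace ℝ E] [FiniteDimensional ℝ E]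
  {L : Type*} [TopologicalSpace L] [ChartedSpace E L] [Group L] [LieGroup 𝓘(ℝ, E) ∞ L]

variable (E) in
/-- The left trivialization of the tangent bundle as a continuous linear equivalence. The Lie
algebra is here regarded as the model space `E`, which is its underlying vector space. -/
def leftTrivL (g : L) : E ≃L[ℝ] TangentSpace 𝓘(ℝ, E) g :=
  (show E ≃L[ℝ] E from
    LinearEquiv.toContinuousLinearEquiv (show E ≃ₗ[ℝ] E from leftTriv (E := E) g))

theorem contMDiff_leftTrivL (ξ : E) : ContMDiff 𝓘(ℝ, E) 𝓘(ℝ, E).tangent ∞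
    (fun g : L ↦ (⟨g, leftTrivL E g ξ⟩ : TangentBundle 𝓘(ℝ, E) L)) :=
  contMDiff_mulInvariantVectorField_infty ξ

theorem mfderiv_mul_left_leftTrivL (a g : L) (ξ : E) :
    mfderiv 𝓘(ℝ, E) 𝓘(ℝ, E) (fun x : L ↦ a * x) g (leftTrivL E g ξ) = leftTrivL E (a * g) ξ :=
  mfderiv_mul_left_mulInvariantVectorField a g ξ

/-- The left-invariant frame near `p`, read in the standard trivialization of the tangent bundle
at `p`. -/
def leftFrame (p g : L) : E →L[ℝ] E :=
  ((trivializationAt E (TangentSpace 𝓘(ℝ, E)) p).continuousLinearMapAt ℝ g).comp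
    (leftTrivL E g : E →L[ℝ] TangentSpace 𝓘(ℝ, E) g)

variable {p g : L}

theorem leftFrame_apply
    (hg : g ∈ (trivializationAt E (TangentSpace 𝓘(ℝ, E) : L → Type _) p).baseSet)
    (ξ : E) : leftFrame p g ξ =
      (trivializationAt E (TangentSpace 𝓘(ℝ, E)) p
        ⟨g, leftTrivL E g ξ⟩).2 :=
  Bundle.Trivialization.continuousLinearMapAt_apply_of_mem ℝ _ hg _

theorem isInvertible_leftFrame
    (hg : g ∈ (trivializationAt E (TangentSpace 𝓘(ℝ, E) : L → Type _) p).baseSet) :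
    (leftFrame (E := E) p g).IsInvertible := by
  rw [leftFrame, ← Bundle.Trivialization.coe_continuousLinearEquivAt_eq' _ hg]
  exact ⟨(leftTrivL E g).trans (Bundle.Trivialization.continuousLinearEquivAt ℝ _ g hg), rfl⟩

theorem contMDiffAt_leftFrame (p : L) :
    ContMDiffAt 𝓘(ℝ, E) 𝓘(ℝ, E →L[ℝ] E) ∞ (leftFrame (E := E) p) p := by
  refine contMDiffAt_clm_of_apply fun ξ ↦ ?_
  have h := (contMDiffAt_section (F := E) p).1
    (contMDiff_leftTrivL ξ p)
  refine h.congr_of_eventuallyEq ?_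
  filter_upwards [baseSet_mem_nhds (E := E) p] with g hg
  exact leftFrame_apply hg ξ

/-- Inversion of linear maps is smooth, hence so is the coframe dual to the left-invariant frame. -/
theorem contMDiffAt_inverse_leftFrame (p : L) :
    ContMDiffAt 𝓘(ℝ, E) 𝓘(ℝ, E →L[ℝ] E) ∞ (fun g ↦ (leftFrame (E := E) p g).inverse) p := by
  obtain ⟨e, he⟩ := isInvertible_leftFrame (mem_baseSet_trivializationAt E (TangentSpace 𝓘(ℝ, E)) p)
  have h : ContDiffAt ℝ ∞ (ContinuousLinearMap.inverse : (E →L[ℝ] E) → E →L[ℝ] E)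
      (leftFrame p p) := by
    rw [← he]
    exact contDiffAt_map_inverse e
  exact h.contMDiffAt.comp p (contMDiffAt_leftFrame p)

/-- The Lie algebra valued function on the group which corresponds to a vector field in the left
trivialization. -/
def leftCoord (Y : Π g : L, TangentSpace 𝓘(ℝ, E) g) (g : L) : E :=
  (leftTrivL E g).symm (Y g)

theorem leftTrivL_leftCoord (Y : Π g : L, TangentSpace 𝓘(ℝ, E) g) (g : L) :
    leftTrivL E g (leftCoord Y g) = Y g :=
  (leftTrivL E g).apply_symm_apply (Y g)

theorem leftCoord_leftTrivL (ξ : E) (g : L) :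
    leftCoord (fun g : L ↦ leftTrivL E g ξ) g = ξ :=
  (leftTrivL E g).symm_apply_apply ξ

theorem leftFrame_leftCoord
    (hg : g ∈ (trivializationAt E (TangentSpace 𝓘(ℝ, E) : L → Type _) p).baseSet)
    (Y : Π g : L, TangentSpace 𝓘(ℝ, E) g) : leftFrame p g (leftCoord Y g) =
      (trivializationAt E (TangentSpace 𝓘(ℝ, E)) p ⟨g, Y g⟩).2 := by
  rw [leftFrame_apply hg, leftTrivL_leftCoord]

theorem leftCoord_eventuallyEq (Y : Π g : L, TangentSpace 𝓘(ℝ, E) g) (p : L) :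
    (leftCoord Y) =ᶠ[𝓝 p] fun g ↦ (leftFrame (E := E) p g).inverse
      (trivializationAt E (TangentSpace 𝓘(ℝ, E)) p ⟨g, Y g⟩).2 := by
  filter_upwards [baseSet_mem_nhds (E := E) p] with g hg
  rw [← leftFrame_leftCoord hg]
  exact ((isInvertible_leftFrame hg).inverse_apply_self _).symm

theorem contMDiffAt_leftCoord {Y : Π g : L, TangentSpace 𝓘(ℝ, E) g}
    (hY : ContMDiffAt 𝓘(ℝ, E) 𝓘(ℝ, E).tangent ∞
      (fun x ↦ (⟨x, Y x⟩ : TangentBundle 𝓘(ℝ, E) L)) p) :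
    ContMDiffAt 𝓘(ℝ, E) 𝓘(ℝ, E) ∞ (leftCoord Y) p :=
  ((contMDiffAt_inverse_leftFrame p).clm_apply
    ((contMDiffAt_section (F := E) p).1 hY)).congr_of_eventuallyEq (leftCoord_eventuallyEq Y p)

theorem mdifferentiableAt_leftCoord {Y : Π g : L, TangentSpace 𝓘(ℝ, E) g}
    (hY : MDifferentiableAt 𝓘(ℝ, E) 𝓘(ℝ, E).tangent
      (fun x ↦ (⟨x, Y x⟩ : TangentBundle 𝓘(ℝ, E) L)) p) :
    MDifferentiableAt 𝓘(ℝ, E) 𝓘(ℝ, E) (leftCoord Y) p :=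
  (((contMDiffAt_inverse_leftFrame p).mdifferentiableAt (by simp)).clm_apply
    ((mdifferentiableAt_section 𝓘(ℝ, E) Y).1 hY)).congr_of_eventuallyEq (leftCoord_eventuallyEq Y p)

/-- A vector field is smooth if its coefficients in the left trivialization are. -/
theorem contMDiffAt_leftTrivL_comp {η : L → E}
    (hη : ContMDiffAt 𝓘(ℝ, E) 𝓘(ℝ, E) ∞ η p) :
    ContMDiffAt 𝓘(ℝ, E) 𝓘(ℝ, E).tangent ∞
      (fun x ↦ (⟨x, leftTrivL E x (η x)⟩ : TangentBundle 𝓘(ℝ, E) L)) p := by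
  refine (contMDiffAt_section (F := E) p).2 ?_
  refine ((contMDiffAt_leftFrame p).clm_apply hη).congr_of_eventuallyEq ?_
  filter_upwards [baseSet_mem_nhds (E := E) p] with g hg
  exact (leftFrame_apply hg (η g)).symm

/-- A field of linear maps on the tangent spaces of a Lie group is smooth if its values on
left-invariant vector fields are. -/
theorem contMDiffAt_hom_of_leftTrivL {F : Type*} [NormedAddCommGroup F] [NormedSpace ℝ F]
    {V : L → Type*} [TopologicalSpace (TotalSpace F V)] [∀ x, AddCommGroup (V x)]
    [∀ x, Module ℝ (V x)] [∀ x, TopologicalSpace (V x)] [∀ x, IsTopologicalAddGroup (V x)]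
    [∀ x, ContinuousSMul ℝ (V x)] [FiberBundle F V] [VectorBundle ℝ F V]
    {T : Π g : L, TangentSpace 𝓘(ℝ, E) g →L[ℝ] V g} {p : L}
    (h : ∀ ξ : E, ContMDiffAt 𝓘(ℝ, E) (𝓘(ℝ, E).prod 𝓘(ℝ, F)) ∞
      (fun g ↦ (⟨g, T g (leftTrivL E g ξ)⟩ : TotalSpace F V)) p) :
    ContMDiffAt 𝓘(ℝ, E) (𝓘(ℝ, E).prod 𝓘(ℝ, E →L[ℝ] F)) ∞
      (fun g ↦ (⟨g, T g⟩ : TotalSpace (E →L[ℝ] F)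
        (fun g : L ↦ TangentSpace 𝓘(ℝ, E) g →L[ℝ] V g))) p := by
  rw [contMDiffAt_hom_bundle]
  refine ⟨contMDiffAt_id, ?_⟩
  let Q : L → E →L[ℝ] F := fun g ↦
    (((trivializationAt F V p).continuousLinearMapAt ℝ g).comp (T g)).comp
      (leftTrivL E g : E →L[ℝ] TangentSpace 𝓘(ℝ, E) g)
  have hV : (trivializationAt F V p).baseSet ∈ 𝓝 p :=
    (trivializationAt F V p).open_baseSet.mem_nhds (mem_baseSet_trivializationAt F V p)
  have hQ : ContMDiffAt 𝓘(ℝ, E) 𝓘(ℝ, E →L[ℝ] F) ∞ Q p := by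
    refine contMDiffAt_clm_of_apply fun ξ ↦ ?_
    refine ((contMDiffAt_section (F := F) p).1 (h ξ)).congr_of_eventuallyEq ?_
    filter_upwards [hV] with g hg
    exact Bundle.Trivialization.continuousLinearMapAt_apply_of_mem ℝ _ hg _
  refine (hQ.clm_comp (contMDiffAt_inverse_leftFrame p)).congr_of_eventuallyEq ?_
  filter_upwards [hV, baseSet_mem_nhds (E := E) p] with g hg hg'
  ext v
  obtain ⟨ξ, rfl⟩ : ∃ ξ, leftFrame (E := E) p g ξ = v :=
    ⟨_, (isInvertible_leftFrame hg').self_apply_inverse v⟩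
  rw [ContinuousLinearMap.comp_apply, (isInvertible_leftFrame hg').inverse_apply_self]
  simp only [ContinuousLinearMap.inCoordinates, leftFrame, Q, ContinuousLinearMap.comp_apply]
  rw [Bundle.Trivialization.symmL_continuousLinearMapAt _ hg']

end LeftFrame

/-! ### Left-invariant connections -/

section

variable {E : Type*} [NormedAddCommGroup E] [NormedSpace ℝ E]
  {M : Type*} [TopologicalSpace M] [ChartedSpace E M]
  {V : Type*} [NormedAddCommGroup V] [NormedSpace ℝ V]
  {W : Type*} [NormedAddCommGroup W] [NormedSpace ℝ W]

/-- The product rule for the application of linear maps to vectors. -/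
theorem mvfderiv_clm_apply {A : M → W →L[ℝ] V} {c : M → W} {x : M}
    (hA : MDifferentiableAt 𝓘(ℝ, E) 𝓘(ℝ, W →L[ℝ] V) A x)
    (hc : MDifferentiableAt 𝓘(ℝ, E) 𝓘(ℝ, W) c x) (v : TangentSpace 𝓘(ℝ, E) x) :
    mvfderiv 𝓘(ℝ, E) (fun y ↦ A y (c y)) x v =
      mvfderiv 𝓘(ℝ, E) (fun y ↦ A y (c x)) x v + A x (mvfderiv 𝓘(ℝ, E) c x v) := by
  have hAc : MDifferentiableAt 𝓘(ℝ, E) 𝓘(ℝ, (W →L[ℝ] V) × W) (fun y ↦ (A y, c y)) x :=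
    hA.prodMk_space hc
  have hb : HasFDerivAt (fun q : (W →L[ℝ] V) × W ↦ q.1 q.2) _ (A x, c x) :=
    isBoundedBilinearMap_apply.hasFDerivAt (A x, c x)
  have h := mvfderiv_comp_vector (u := fun q : (W →L[ℝ] V) × W ↦ q.1 q.2)
    (f := fun y ↦ (A y, c y)) x hb.differentiableAt.mdifferentiableAt hAc v
  rw [mvfderiv_eq_fderiv, hb.fderiv] at h
  have h1 := mvfderiv_clm_comp (ContinuousLinearMap.fst ℝ (W →L[ℝ] V) W) hAc v
  have h2 := mvfderiv_clm_comp (ContinuousLinearMap.snd ℝ (W →L[ℝ] V) W) hAc v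
  have h3 := mvfderiv_clm_comp (ContinuousLinearMap.apply ℝ V (c x)) hA v
  simp only [ContinuousLinearMap.coe_fst', ContinuousLinearMap.coe_snd',
    ContinuousLinearMap.apply_apply] at h1 h2 h3
  rw [h3, h1, h2]
  refine h.trans ?_
  rw [add_comm]
  rfl

end

section InvariantConnection

variable {E : Type*} [NormedAddCommGroup E] [NormedSpace ℝ E] [FiniteDimensional ℝ E]
  {L : Type*} [TopologicalSpace L] [ChartedSpace E L] [Group L] [LieGroup 𝓘(ℝ, E) ∞ L]
  {p g : L}

theorem leftCoord_add (Y Y' : Π g : L, TangentSpace 𝓘(ℝ, E) g) :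
    leftCoord (Y + Y') = leftCoord Y + leftCoord Y' :=
  funext fun g ↦ map_add (leftTrivL E g).symm _ _

theorem leftCoord_smul (a : L → ℝ) (Y : Π g : L, TangentSpace 𝓘(ℝ, E) g) :
    leftCoord (a • Y) = a • leftCoord Y :=
  funext fun g ↦ map_smul (leftTrivL E g).symm _ _

/-- The operator of the left-invariant connection with given values at the identity on
left-invariant fields. -/
def invariantConnOp (L : Type*) [TopologicalSpace L] [ChartedSpace E L] [Group L]
    [LieGroup 𝓘(ℝ, E) ∞ L] (b : E →L[ℝ] E →L[ℝ] E) : ConnOp E L := fun Y g ↦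
  (leftTrivL E g : E →L[ℝ] TangentSpace 𝓘(ℝ, E) g).comp
    (mvfderiv 𝓘(ℝ, E) (leftCoord Y) g +
      (b.flip (leftCoord Y g)).comp ((leftTrivL E g).symm : TangentSpace 𝓘(ℝ, E) g →L[ℝ] E))

theorem invariantConnOp_leftTrivL (b : E →L[ℝ] E →L[ℝ] E) (Y : Π g : L, TangentSpace 𝓘(ℝ, E) g)
    (g : L) (ξ : E) :
    invariantConnOp L b Y g (leftTrivL E g ξ) = leftTrivL E g
      (mvfderiv 𝓘(ℝ, E) (leftCoord Y) g (leftTrivL E g ξ) + b ξ (leftCoord Y g)) := by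
  simp only [invariantConnOp, ContinuousLinearMap.comp_apply, add_apply,
    ContinuousLinearEquiv.coe_coe, ContinuousLinearEquiv.symm_apply_apply,
    ContinuousLinearMap.flip_apply]

/-- The left-invariant connection with given values at the identity on left-invariant fields. -/
def invariantConn (L : Type*) [TopologicalSpace L] [ChartedSpace E L] [Group L]
    [LieGroup 𝓘(ℝ, E) ∞ L] (b : E →L[ℝ] E →L[ℝ] E) :
    CovariantDerivative 𝓘(ℝ, E) E (TangentSpace 𝓘(ℝ, E) : L → Type _) where
  toFun := invariantConnOp L b
  isCovariantDerivativeOnUniv :=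
    { add := fun {Y Y' g} hY hY' _ ↦ by
        ext v
        obtain ⟨ξ, rfl⟩ := (leftTrivL E g).surjective v
        rw [add_apply, invariantConnOp_leftTrivL, invariantConnOp_leftTrivL,
          invariantConnOp_leftTrivL, leftCoord_add,
          mvfderiv_add (mdifferentiableAt_leftCoord hY) (mdifferentiableAt_leftCoord hY'),
          ← map_add, Pi.add_apply, map_add (b ξ), add_apply]
        congr 1
        abel
      leibniz := fun {Y a g} hY ha _ ↦ by
        ext v
        obtain ⟨ξ, rfl⟩ := (leftTrivL E g).surjective v
        rw [add_apply, smul_apply, ContinuousLinearMap.smulRight_apply,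
          invariantConnOp_leftTrivL, invariantConnOp_leftTrivL, leftCoord_smul, Pi.smul_apply',
          mvfderiv_smul ha (mdifferentiableAt_leftCoord hY), ← leftTrivL_leftCoord Y g,
          map_smul (b ξ), ← map_smul (leftTrivL E g), ← map_smul (leftTrivL E g),
          ← map_add (leftTrivL E g), add_apply, smul_apply, ContinuousLinearMap.smulRight_apply]
        congr 1
        module }

variable {b : E →L[ℝ] E →L[ℝ] E}

theorem contMDiff_leftCoord {Y : Π g : L, TangentSpace 𝓘(ℝ, E) g}
    (hY : ContMDiff 𝓘(ℝ, E) 𝓘(ℝ, E).tangent ∞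
      (fun x ↦ (⟨x, Y x⟩ : TangentBundle 𝓘(ℝ, E) L))) :
    ContMDiff 𝓘(ℝ, E) 𝓘(ℝ, E) ∞ (leftCoord Y) := fun g ↦ contMDiffAt_leftCoord (hY g)

theorem contMDiff_invariantConn : (invariantConn L b).ContMDiffCovariantDerivative ∞ := by
  refine ⟨⟨fun {Y} hY ↦ ?_⟩⟩
  have hY' : ContMDiff 𝓘(ℝ, E) 𝓘(ℝ, E) ∞ (leftCoord Y) :=
    contMDiff_leftCoord (contMDiffOn_univ.1 (hY.of_le le_self_add))
  refine contMDiffOn_univ.2 fun p ↦ contMDiffAt_hom_of_leftTrivL fun ξ ↦ ?_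
  have h1 : ContMDiff 𝓘(ℝ, E) 𝓘(ℝ, E) ∞
      (fun g ↦ mvfderiv 𝓘(ℝ, E) (leftCoord Y) g (leftTrivL E g ξ)) :=
    contMDiffOn_univ.1 (contMDiffOn_mvfderiv_apply isOpen_univ hY'.contMDiffOn
      (contMDiff_leftTrivL ξ).contMDiffOn)
  have h2 : ContMDiff 𝓘(ℝ, E) 𝓘(ℝ, E) ∞ (fun g ↦ b ξ (leftCoord Y g)) :=
    (b ξ).contMDiff.comp hY'
  refine (contMDiffAt_leftTrivL_comp ((h1.add h2) p)).congr_of_eventuallyEq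
    (Eventually.of_forall fun g ↦ ?_)
  exact congrArg (TotalSpace.mk g) (invariantConnOp_leftTrivL b Y g ξ)

theorem mlieBracket_leftTrivL (g : L) (ξ η : GroupLieAlgebra 𝓘(ℝ, E) L) :
    mlieBracket 𝓘(ℝ, E) (fun g : L ↦ leftTrivL E g ξ) (fun g ↦ leftTrivL E g η) g =
      leftTrivL E g (⁅ξ, η⁆ : GroupLieAlgebra 𝓘(ℝ, E) L) :=
  (congrFun (mulInvariantVector_mlieBracket (I := 𝓘(ℝ, E)) (G := L) ξ η) g).symm

theorem invariantConn_leftTrivL (g : L) (ξ η : E) :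
    invariantConn L b (fun g : L ↦ leftTrivL E g η) g (leftTrivL E g ξ) =
      leftTrivL E g (b ξ η) := by
  refine (invariantConnOp_leftTrivL b _ g ξ).trans ?_
  have h3 : leftCoord (fun g : L ↦ leftTrivL E g η) = fun _ ↦ η :=
    funext fun g ↦ leftCoord_leftTrivL η g
  rw [h3, mvfderiv_const, zero_apply, zero_add]

theorem torsion_invariantConn
    (hb : ∀ ξ η : GroupLieAlgebra 𝓘(ℝ, E) L,
      (⁅ξ, η⁆ : GroupLieAlgebra 𝓘(ℝ, E) L) = b ξ η - b η ξ) :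
    (invariantConn L b).torsion = 0 := by
  funext g
  ext v w
  obtain ⟨ξ, rfl⟩ := (leftTrivL E g).surjective v
  obtain ⟨η, rfl⟩ := (leftTrivL E g).surjective w
  have h1 := (invariantConn L b).torsion_apply
    ((contMDiff_leftTrivL ξ).mdifferentiable (by simp) g)
    ((contMDiff_leftTrivL η).mdifferentiable (by simp) g)
  have hbr := mlieBracket_leftTrivL (E := E) g ξ η
  rw [hb ξ η] at hbr
  rw [invariantConn_leftTrivL, invariantConn_leftTrivL, hbr, ← map_sub, sub_self] at h1
  exact h1

theorem leftCoord_mpullback_mul_left (a : L) (Y : Π g : L, TangentSpace 𝓘(ℝ, E) g) :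
    leftCoord (mpullback 𝓘(ℝ, E) 𝓘(ℝ, E) (fun x : L ↦ a * x) Y) = fun g ↦ leftCoord Y (a * g) := by
  funext g
  have h1 := mfderiv_mul_left_leftTrivL (E := E) a g (leftCoord Y (a * g))
  rw [leftTrivL_leftCoord] at h1
  rw [leftCoord, mpullback, ← h1, (isInvertible_mfderiv_mul_left a g).inverse_apply_self,
    ContinuousLinearEquiv.symm_apply_apply]

/-- Left translations preserve the connection itself, so the one-form can be taken to be zero. -/
theorem projEquivOn_mul_left_invariantConn (a : L) :
    ProjEquivOn univ (pullbackConn (fun x : L ↦ a * x) (fun x : L ↦ a⁻¹ * x) (invariantConn L b))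
      (invariantConn L b) := by
  refine ⟨0, ?_, fun X Y hX hY g _ ↦ ?_⟩
  · exact contMDiff_zeroSection _ _ |>.contMDiffOn
  · have hY' := contMDiff_leftCoord (contMDiffOn_univ.1 hY)
    obtain ⟨ξ, hξ⟩ : ∃ ξ : E, leftTrivL E g ξ = X g := ⟨_, leftTrivL_leftCoord X g⟩
    have h1 : mvfderiv 𝓘(ℝ, E) (fun x ↦ leftCoord Y (a⁻¹ * x)) (a * g) (leftTrivL E (a * g) ξ) =
        mvfderiv 𝓘(ℝ, E) (leftCoord Y) g (leftTrivL E g ξ) := by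
      have h := leftD_comp_mul_left (E := E) (u := leftCoord Y) (g := a * g) (ξ := ξ) a⁻¹
        (hY'.mdifferentiable (by simp) _)
      rw [inv_mul_cancel_left] at h
      exact h
    have h2 : invariantConnOp L b (mpullback 𝓘(ℝ, E) 𝓘(ℝ, E) (fun x : L ↦ a⁻¹ * x) Y) (a * g)
        (mfderiv 𝓘(ℝ, E) 𝓘(ℝ, E) (fun x : L ↦ a * x) g (X g)) =
        mfderiv 𝓘(ℝ, E) 𝓘(ℝ, E) (fun x : L ↦ a * x) g (invariantConnOp L b Y g (X g)) := by
      rw [← hξ, mfderiv_mul_left_leftTrivL, invariantConnOp_leftTrivL, invariantConnOp_leftTrivL,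
        mfderiv_mul_left_leftTrivL, leftCoord_mpullback_mul_left, h1]
      dsimp only
      rw [inv_mul_cancel_left]
    have h3 : pullbackConn (fun x : L ↦ a * x) (fun x : L ↦ a⁻¹ * x) (invariantConn L b) Y g (X g) =
        invariantConn L b Y g (X g) := by
      have h4 := congrArg (mfderiv 𝓘(ℝ, E) 𝓘(ℝ, E) (fun x : L ↦ a * x) g).inverse h2
      rw [(isInvertible_mfderiv_mul_left a g).inverse_apply_self] at h4
      exact h4
    rw [h3, sub_self]
    simp

/-- A chart is flat for the projective class of a left-invariant connection as soon as its second
derivatives along left-invariant fields are those of the connection up to a term of projective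
type; arbitrary vector fields are treated by the product rule. -/
theorem projEquivOn_stdConn_invariantConn {f : OpenPartialHomeomorph L E}
    (hf : ContMDiffOn 𝓘(ℝ, E) 𝓘(ℝ, E) ∞ f f.source)
    (hf' : ContMDiffOn 𝓘(ℝ, E) 𝓘(ℝ, E) ∞ f.symm f.target) {θ : L → E →L[ℝ] ℝ}
    (hθ : ∀ ξ, ContMDiffOn 𝓘(ℝ, E) 𝓘(ℝ, ℝ) ∞ (fun g ↦ θ g ξ) f.source)
    (hsecond : ∀ g ∈ f.source, ∀ ξ η : E,
      mvfderiv 𝓘(ℝ, E) (fun h ↦ mvfderiv 𝓘(ℝ, E) f h (leftTrivL E h η)) g (leftTrivL E g ξ) =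
        mvfderiv 𝓘(ℝ, E) f g (leftTrivL E g (b ξ η)) +
          θ g ξ • mvfderiv 𝓘(ℝ, E) f g (leftTrivL E g η) +
          θ g η • mvfderiv 𝓘(ℝ, E) f g (leftTrivL E g ξ)) :
    ProjEquivOn f.source (pullbackConn f f.symm (stdConn E)) (invariantConn L b) := by
  have hfd : f.MDifferentiable 𝓘(ℝ, E) 𝓘(ℝ, E) :=
    ⟨hf.mdifferentiableOn (by simp), hf'.mdifferentiableOn (by simp)⟩
  let φ : Π g : L, TangentSpace 𝓘(ℝ, E) g →L[ℝ] ℝ := fun g ↦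
    (θ g).comp ((leftTrivL E g).symm : TangentSpace 𝓘(ℝ, E) g →L[ℝ] E)
  have hφ : ∀ g ξ, φ g (leftTrivL E g ξ) = θ g ξ := fun g ξ ↦
    congrArg (θ g) ((leftTrivL E g).symm_apply_apply ξ)
  refine ⟨φ, fun p hp ↦ ?_, fun X Y hX hY g hg ↦ ?_⟩
  · have h1 : ∀ ξ : E, ContMDiffAt 𝓘(ℝ, E) (𝓘(ℝ, E).prod 𝓘(ℝ, ℝ)) ∞
        (fun g ↦ (⟨g, φ g (leftTrivL E g ξ)⟩ :
          TotalSpace ℝ (Bundle.Trivial L ℝ))) p := by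
      intro ξ
      rw [contMDiffAt_section]
      refine ((hθ ξ).contMDiffAt (f.open_source.mem_nhds hp)).congr_of_eventuallyEq
        (Eventually.of_forall fun g ↦ ?_)
      exact hφ g ξ
    exact (contMDiffAt_hom_of_leftTrivL (V := Bundle.Trivial L ℝ) h1).contMDiffWithinAt
  · have hinv : (mfderiv 𝓘(ℝ, E) 𝓘(ℝ, E) f g).IsInvertible := ⟨hfd.mfderiv hg, rfl⟩
    obtain ⟨ξ, hξ⟩ : ∃ ξ : E, leftTrivL E g ξ = X g := ⟨_, leftTrivL_leftCoord X g⟩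
    have hc := contMDiffAt_leftCoord (hY.contMDiffAt (f.open_source.mem_nhds hg))
    let A : L → E →L[ℝ] E := fun h ↦
      (mvfderiv 𝓘(ℝ, E) f h).comp (leftTrivL E h : E →L[ℝ] TangentSpace 𝓘(ℝ, E) h)
    have hA : ContMDiffAt 𝓘(ℝ, E) 𝓘(ℝ, E →L[ℝ] E) ∞ A g := contMDiffAt_clm_of_apply fun w ↦
      (contMDiffOn_mvfderiv_apply f.open_source hf (contMDiff_leftTrivL w).contMDiffOn).contMDiffAt
        (f.open_source.mem_nhds hg)
    have h1 := mvfderiv_clm_apply (hA.mdifferentiableAt (by simp))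
      (hc.mdifferentiableAt (by simp)) (leftTrivL E g ξ)
    have h2 : (fun h ↦ A h (leftCoord Y h)) = fun h ↦ mvfderiv 𝓘(ℝ, E) f h (Y h) := by
      funext h
      simp only [A, ContinuousLinearMap.comp_apply, ContinuousLinearEquiv.coe_coe,
        leftTrivL_leftCoord]
    rw [h2] at h1
    apply hinv.injective
    rw [map_sub, mfderiv_pullbackConn_stdConn hf hf' hg hY, ← hξ]
    have h3 : invariantConn L b Y g (leftTrivL E g ξ) = _ := invariantConnOp_leftTrivL b Y g ξ
    have h4 : φ g (Y g) = θ g (leftCoord Y g) := rfl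
    have h5 : ∀ w : TangentSpace 𝓘(ℝ, E) g,
      mfderiv 𝓘(ℝ, E) 𝓘(ℝ, E) f g w = mvfderiv 𝓘(ℝ, E) f g w := fun _ ↦ rfl
    have h6 : mvfderiv 𝓘(ℝ, E) (fun y ↦ A y (leftCoord Y g)) g (leftTrivL E g ξ) = _ :=
      hsecond g hg ξ (leftCoord Y g)
    rw [h6, leftTrivL_leftCoord] at h1
    rw [h3, hφ, h4, h5, h5, h1, map_add (leftTrivL E g), map_add, map_add, map_smul, map_smul]
    simp only [A, ContinuousLinearMap.comp_apply, ContinuousLinearEquiv.coe_coe]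
    have h7 : ∀ p q r s : E, p + r + s + q - (q + p) = r + s := fun p q r s ↦ by abel
    exact h7 _ _ _ _

end InvariantConnection

/-! ### The inverse function theorem -/

section InverseFunction

variable {E : Type*} [NormedAddCommGroup E] [NormedSpace ℝ E] [FiniteDimensional ℝ E]

theorem isInvertible_of_injective {A : E →L[ℝ] E} (hA : Function.Injective A) : A.IsInvertible :=
  ⟨(LinearEquiv.ofInjectiveEndo A.toLinearMap hA).toContinuousLinearEquiv, by ext; rfl⟩

/-- The inverse function theorem, with an inverse which is smooth on a whole neighbourhood. -/
theorem exists_openPartialHomeomorph_of_contDiffOn {h : E → E} {V : Set E} {a : E} (hV : IsOpen V)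
    (ha : a ∈ V) (hh : ContDiffOn ℝ ∞ h V) (hinv : (fderiv ℝ h a).IsInvertible) :
    ∃ φ : OpenPartialHomeomorph E E, a ∈ φ.source ∧ φ.source ⊆ V ∧ ⇑φ = h ∧
      ContDiffOn ℝ ∞ φ.symm φ.target := by
  have hat : ∀ x ∈ V, ContDiffAt ℝ ∞ h x := fun x hx ↦ hh.contDiffAt (hV.mem_nhds hx)
  have hd : ∀ x ∈ V, HasFDerivAt h (fderiv ℝ h x) x := fun x hx ↦
    ((hat x hx).differentiableAt (by simp)).hasFDerivAt
  obtain ⟨e, he⟩ := hinv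
  let φ₀ := (hat a ha).toOpenPartialHomeomorph h (he ▸ hd a ha : HasFDerivAt h (e : E →L[ℝ] E) a)
    (by simp)
  have ha₀ : a ∈ φ₀.source := ContDiffAt.mem_toOpenPartialHomeomorph_source _ _ _
  have hφ₀ : ⇑φ₀ = h := ContDiffAt.toOpenPartialHomeomorph_coe _ _ _
  -- on the open set where the derivative is invertible the inverse is smooth
  let W : Set E := V ∩ fderiv ℝ h ⁻¹' range ((↑) : (E ≃L[ℝ] E) → E →L[ℝ] E)
  have hW : IsOpen W :=
    (hh.continuousOn_fderiv_of_isOpen hV (by simp)).isOpen_inter_preimage hV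
      ContinuousLinearEquiv.isOpen
  have haW : a ∈ W := ⟨ha, e, he⟩
  refine ⟨φ₀.restrOpen W hW, ⟨ha₀, haW⟩, fun x hx ↦ hx.2.1, hφ₀, fun y hy ↦ ?_⟩
  have hy' : φ₀.symm y ∈ W := ((φ₀.restrOpen W hW).map_target hy).2
  have hy₀ : y ∈ φ₀.target := hy.1
  obtain ⟨hV', e', he'⟩ := hy'
  refine ContDiffAt.contDiffWithinAt ?_
  refine φ₀.contDiffAt_symm hy₀ (f₀' := e') ?_ ?_
  · rw [hφ₀, he']; exact hd _ hV'
  · rw [hφ₀]; exact hat _ hV'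

variable {M : Type*} [TopologicalSpace M] [ChartedSpace E M] [IsManifold 𝓘(ℝ, E) ∞ M]

/-- The inverse function theorem for maps from a manifold to its model space. -/
theorem exists_openPartialHomeomorph_of_contMDiffOn {f : M → E} {U : Set M} {p : M}
    (hU : IsOpen U) (hp : p ∈ U) (hf : ContMDiffOn 𝓘(ℝ, E) 𝓘(ℝ, E) ∞ f U)
    (hinj : Function.Injective (mvfderiv 𝓘(ℝ, E) f p)) :
    ∃ φ : OpenPartialHomeomorph M E, p ∈ φ.source ∧ φ.source ⊆ U ∧ EqOn φ f φ.source ∧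
      ContMDiffOn 𝓘(ℝ, E) 𝓘(ℝ, E) ∞ φ φ.source ∧
      ContMDiffOn 𝓘(ℝ, E) 𝓘(ℝ, E) ∞ φ.symm φ.target := by
  obtain ⟨c, hc, hcp, hcs, hcs'⟩ : ∃ c : OpenPartialHomeomorph M E,
      c.MDifferentiable 𝓘(ℝ, E) 𝓘(ℝ, E) ∧ p ∈ c.source ∧
      ContMDiffOn 𝓘(ℝ, E) 𝓘(ℝ, E) ∞ c c.source ∧
      ContMDiffOn 𝓘(ℝ, E) 𝓘(ℝ, E) ∞ c.symm c.target :=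
    ⟨chartAt E p, mdifferentiable_chart p, mem_chart_source E p, contMDiffOn_chart,
      contMDiffOn_chart_symm⟩
  let V : Set E := c.target ∩ c.symm ⁻¹' U
  have hV : IsOpen V := c.isOpen_inter_preimage_symm hU
  have hcV : c p ∈ V := ⟨c.map_source hcp, by simpa [c.left_inv hcp] using hp⟩
  have hh : ContDiffOn ℝ ∞ (f ∘ c.symm) V :=
    (hf.comp (hcs'.mono inter_subset_left) (fun x hx ↦ hx.2)).contDiffOn
  have hhd : DifferentiableAt ℝ (f ∘ c.symm) (c p) :=
    (hh.contDiffAt (hV.mem_nhds hcV)).differentiableAt (by simp)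
  have hinv : (fderiv ℝ (f ∘ c.symm) (c p)).IsInvertible := by
    refine isInvertible_of_injective ((injective_iff_map_eq_zero _).2 fun w hw ↦ ?_)
    obtain ⟨v, rfl⟩ := hc.mfderiv_surjective hcp w
    have h1 : f =ᶠ[𝓝 p] (f ∘ c.symm) ∘ c := by
      filter_upwards [c.open_source.mem_nhds hcp] with x hx
      simp [c.left_inv hx]
    have h2 := mvfderiv_comp_vector (u := f ∘ c.symm) (f := c) p hhd.mdifferentiableAt
      (hc.mdifferentiableAt hcp) v
    rw [mvfderiv_eq_fderiv, ← mvfderiv_congr h1] at h2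
    have h3 : v = 0 := hinj ((h2.trans hw).trans (map_zero _).symm)
    rw [h3]; exact map_zero _
  obtain ⟨φ, hφp, hφV, hφ, hφs⟩ := exists_openPartialHomeomorph_of_contDiffOn hV hcV hh hinv
  have hsrc : ∀ x ∈ (c.trans φ).source, x ∈ c.source ∧ c x ∈ φ.source := fun x hx ↦ by
    simpa using hx
  have hU' : (c.trans φ).source ⊆ U := fun x hx ↦ by
    have := (hφV (hsrc x hx).2).2
    rwa [mem_preimage, c.left_inv (hsrc x hx).1] at this
  have heq : EqOn (c.trans φ) f (c.trans φ).source := fun x hx ↦ by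
    simp [hφ, c.left_inv (hsrc x hx).1]
  refine ⟨c.trans φ, by simp [hcp, hφp], hU', heq, (hf.mono hU').congr heq, ?_⟩
  have : (c.trans φ).target ⊆ φ.target ∩ φ.symm ⁻¹' c.target := by simp
  exact hcs'.comp (hφs.contMDiffOn.mono fun x hx ↦ (this hx).1) fun x hx ↦ (this hx).2

end InverseFunction

/-! ### From homogeneous lifts to projective structures -/

section LiftToConnection

variable {E : Type*} [NormedAddCommGroup E] [NormedSpace ℝ E] [FiniteDimensional ℝ E]
  {L : Type*} [TopologicalSpace L] [ChartedSpace E L] [Group L] [LieGroup 𝓘(ℝ, E) ∞ L]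

/-- A flat chart at the identity, compatible with the left-invariant connection of `b` up to a
term of projective type, makes the projective class of this connection flat everywhere. -/
theorem isIFPS_invariantConn {b : E →L[ℝ] E →L[ℝ] E}
    (hb : ∀ ξ η : GroupLieAlgebra 𝓘(ℝ, E) L,
      (⁅ξ, η⁆ : GroupLieAlgebra 𝓘(ℝ, E) L) = b ξ η - b η ξ)
    {f : OpenPartialHomeomorph L E} (h1 : 1 ∈ f.source)
    (hf : ContMDiffOn 𝓘(ℝ, E) 𝓘(ℝ, E) ∞ f f.source)
    (hf' : ContMDiffOn 𝓘(ℝ, E) 𝓘(ℝ, E) ∞ f.symm f.target) {θ : L → E →L[ℝ] ℝ}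
    (hθ : ∀ ξ, ContMDiffOn 𝓘(ℝ, E) 𝓘(ℝ, ℝ) ∞ (fun g ↦ θ g ξ) f.source)
    (hsecond : ∀ g ∈ f.source, ∀ ξ η ζ : GroupLieAlgebra 𝓘(ℝ, E) L, ζ = b ξ η →
      leftD ξ (leftD η f) g = leftD ζ f g + θ g ξ • leftD η f g + θ g η • leftD ξ f g) :
    IsIFPS (invariantConn L b) := by
  refine ⟨contMDiff_invariantConn, torsion_invariantConn hb, fun p ↦ ?_,
    projEquivOn_mul_left_invariantConn⟩
  have := topologicalGroup_of_lieGroup 𝓘(ℝ, E) ∞ (G := L)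
  let l := (Homeomorph.mulLeft p⁻¹).toOpenPartialHomeomorph
  have hlc : ∀ x, (l.trans f) x = f (p⁻¹ * x) := fun x ↦ rfl
  have hsrc : ∀ x, x ∈ (l.trans f).source → p⁻¹ * x ∈ f.source := fun x hx ↦ by
    simpa [l] using hx
  have hl : ContMDiff 𝓘(ℝ, E) 𝓘(ℝ, E) ∞ (fun x : L ↦ p⁻¹ * x) := contMDiff_mul_left
  have hl' : ContMDiff 𝓘(ℝ, E) 𝓘(ℝ, E) ∞ l.symm := contMDiff_mul_left (a := p⁻¹⁻¹)
  have hs : ContMDiffOn 𝓘(ℝ, E) 𝓘(ℝ, E) ∞ (l.trans f) (l.trans f).source :=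
    hf.comp hl.contMDiffOn hsrc
  have hs' : ContMDiffOn 𝓘(ℝ, E) 𝓘(ℝ, E) ∞ (l.trans f).symm (l.trans f).target :=
    hl'.comp_contMDiffOn (hf'.mono (by simp [l]))
  refine ⟨l.trans f, by simp [l, h1], hs, hs', ?_⟩
  refine projEquivOn_stdConn_invariantConn hs hs' (θ := fun g ↦ θ (p⁻¹ * g))
    (fun ξ ↦ (hθ ξ).comp hl.contMDiffOn hsrc) fun g hg ξ η ↦ ?_
  have e1 : ∀ ζ : GroupLieAlgebra 𝓘(ℝ, E) L, ∀ x ∈ (l.trans f).source,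
      leftD ζ (l.trans f) x = leftD ζ f (p⁻¹ * x) := fun ζ x hx ↦
    leftD_comp_mul_left p⁻¹ (mdifferentiableAt_of_contMDiffOn f.open_source (hsrc x hx) hf)
  have e2 : ∀ ξ η : GroupLieAlgebra 𝓘(ℝ, E) L,
      leftD ξ (leftD η (l.trans f)) g = leftD ξ (leftD η f) (p⁻¹ * g) := by
    intro ξ η
    rw [leftD_congr_of_isOpen (l.trans f).open_source hg (e1 η)]
    exact leftD_comp_mul_left p⁻¹ (mdifferentiableAt_of_contMDiffOn f.open_source (hsrc g hg)
      (contMDiffOn_leftD f.open_source hf η))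
  have key : ∀ ξ η ζ : GroupLieAlgebra 𝓘(ℝ, E) L, ζ = b ξ η →
      leftD ξ (leftD η (l.trans f)) g = leftD ζ (l.trans f) g +
        θ (p⁻¹ * g) ξ • leftD η (l.trans f) g + θ (p⁻¹ * g) η • leftD ξ (l.trans f) g := by
    intro ξ η ζ hζ
    rw [e2, e1 _ g hg, e1 _ g hg, e1 _ g hg, hsecond _ (hsrc g hg) ξ η ζ hζ]
  exact key ξ η _ rfl

/-- The quotient of the components of a homogeneous lift is a flat chart for the left-invariant
connection whose coefficients are those of the first-order terms in the system for the lift. -/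
theorem IsHomogeneousLift.lieGroupAdmitsIFPS {V : Type*} [NormedAddCommGroup V] [NormedSpace ℝ V]
    [FiniteDimensional ℝ V] {U : Set L} {F : L → V} (h : IsHomogeneousLift (E := E) U F) :
    LieGroupAdmitsIFPS E L := by
  -- coordinates on `V` in which `F` and its first derivatives at `1` are the standard frame
  obtain ⟨P, Q, hP, hQ, hP1, hQ1⟩ : ∃ (P : V →L[ℝ] E) (Q : V →L[ℝ] ℝ),
      (∀ ξ : GroupLieAlgebra 𝓘(ℝ, E) L, P (leftD ξ F 1) = ξ) ∧
      (∀ ξ : GroupLieAlgebra 𝓘(ℝ, E) L, Q (leftD ξ F 1) = 0) ∧ P (F 1) = 0 ∧ Q (F 1) = 1 := by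
    let Φ : GroupLieAlgebra 𝓘(ℝ, E) L × ℝ →ₗ[ℝ] V :=
      (leftDₗ F 1).coprod (LinearMap.toSpanSingleton ℝ V (F 1))
    have hΦ : ∀ ξ c, Φ (ξ, c) = leftD ξ F 1 + c • F 1 := fun ξ c ↦ rfl
    have hinj : Function.Injective Φ := by
      refine (injective_iff_map_eq_zero _).2 fun ⟨ξ, c⟩ h0 ↦ ?_
      obtain ⟨rfl, rfl⟩ := h.independent ξ c h0
      rfl
    have hdim : Module.finrank ℝ (GroupLieAlgebra 𝓘(ℝ, E) L × ℝ) = Module.finrank ℝ V := by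
      rw [h.finrank_eq, Module.finrank_prod, finrank_groupLieAlgebra, Module.finrank_self]
    let e := LinearEquiv.ofBijective Φ
      ⟨hinj, (LinearMap.injective_iff_surjective_of_finrank_eq_finrank hdim).1 hinj⟩
    have he : ∀ ξ c, e.symm (leftD ξ F 1 + c • F 1) = (ξ, c) := fun ξ c ↦ by
      rw [← hΦ]; exact e.symm_apply_apply (ξ, c)
    have he1 : ∀ ξ, e.symm (leftD ξ F 1) = (ξ, 0) := fun ξ ↦ by simpa using he ξ 0
    have he2 : e.symm (F 1) = (0, 1) := by simpa [leftD_zero_left] using he 0 1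
    let P : V →ₗ[ℝ] E := (LinearMap.fst ℝ (GroupLieAlgebra 𝓘(ℝ, E) L) ℝ).comp e.symm.toLinearMap
    let Q : V →ₗ[ℝ] ℝ := (LinearMap.snd ℝ (GroupLieAlgebra 𝓘(ℝ, E) L) ℝ).comp e.symm.toLinearMap
    exact ⟨LinearMap.toContinuousLinearMap P, LinearMap.toContinuousLinearMap Q,
      fun ξ ↦ congrArg Prod.fst (he1 ξ), fun ξ ↦ congrArg Prod.snd (he1 ξ),
      congrArg Prod.fst he2, congrArg Prod.snd he2⟩
  have dF : ∀ g ∈ U, MDifferentiableAt 𝓘(ℝ, E) 𝓘(ℝ, V) F g := fun g hg ↦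
    mdifferentiableAt_of_contMDiffOn h.isOpen hg h.smooth
  have sD := contMDiffOn_leftD h.isOpen h.smooth
  have dD : ∀ η : GroupLieAlgebra 𝓘(ℝ, E) L, ∀ g ∈ U,
      MDifferentiableAt 𝓘(ℝ, E) 𝓘(ℝ, V) (leftD η F) g := fun η g hg ↦
    mdifferentiableAt_of_contMDiffOn h.isOpen hg (sD η)
  -- the coefficients of the second derivatives
  let B : GroupLieAlgebra 𝓘(ℝ, E) L →ₗ[ℝ] GroupLieAlgebra 𝓘(ℝ, E) L →ₗ[ℝ] E :=
    LinearMap.mk₂ ℝ (fun ξ η ↦ P (leftD ξ (leftD η F) 1))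
      (fun ξ ξ' η ↦ by rw [leftD_add_left, map_add])
      (fun c ξ η ↦ by rw [leftD_smul_left, map_smul])
      (fun ξ η η' ↦ by
        have e1 : leftD (η + η') F = fun x ↦ leftD η F x + leftD η' F x :=
          funext fun _ ↦ leftD_add_left
        rw [e1, leftD_add (dD _ _ h.one_mem) (dD _ _ h.one_mem), map_add])
      (fun c ξ η ↦ by
        have e1 : leftD (c • η) F = fun x ↦ c • leftD η F x := funext fun _ ↦ leftD_smul_left c
        rw [e1, leftD_const_smul _ (dD _ _ h.one_mem), map_smul])
  have hB : ∀ ξ η, B ξ η = P (leftD ξ (leftD η F) 1) := fun _ _ ↦ rfl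
  have hsecF : ∀ ξ η ζ : GroupLieAlgebra 𝓘(ℝ, E) L, ζ = B ξ η → ∃ c : ℝ, ∀ g ∈ U,
      leftD ξ (leftD η F) g = leftD ζ F g + c • F g := by
    rintro ξ η _ rfl
    obtain ⟨ζ, c, hζ⟩ := h.second ξ η
    have e1 : B ξ η = ζ := by
      rw [hB, hζ 1 h.one_mem, map_add, map_smul, hP1, smul_zero, add_zero, hP]
    exact ⟨c, fun g hg ↦ by rw [hζ g hg]; exact congrArg (fun z ↦ leftD z F g + c • F g) e1.symm⟩
  have hbr : ∀ ξ η : GroupLieAlgebra 𝓘(ℝ, E) L,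
      (⁅ξ, η⁆ : GroupLieAlgebra 𝓘(ℝ, E) L) = B ξ η - B η ξ := by
    intro ξ η
    rw [hB, hB, ← map_sub, leftD_leftD_sub h.isOpen h.one_mem h.smooth, hP]
  -- the affine coordinate `f` of the projective map defined by `F`
  let u : L → E := fun g ↦ P (F g)
  let l : L → ℝ := fun g ↦ Q (F g)
  have su : ContMDiffOn 𝓘(ℝ, E) 𝓘(ℝ, E) ∞ u U := P.contMDiff.comp_contMDiffOn h.smooth
  have sl : ContMDiffOn 𝓘(ℝ, E) 𝓘(ℝ, ℝ) ∞ l U := Q.contMDiff.comp_contMDiffOn h.smooth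
  have hu : ∀ g ∈ U, ∀ ξ : GroupLieAlgebra 𝓘(ℝ, E) L, leftD ξ u g = P (leftD ξ F g) :=
    fun g hg ξ ↦ leftD_clm P (dF g hg)
  have hl : ∀ g ∈ U, ∀ ξ : GroupLieAlgebra 𝓘(ℝ, E) L, leftD ξ l g = Q (leftD ξ F g) :=
    fun g hg ξ ↦ leftD_clm Q (dF g hg)
  let U' : Set L := U ∩ l ⁻¹' {0}ᶜ
  have hU' : IsOpen U' := sl.continuousOn.isOpen_inter_preimage h.isOpen isOpen_compl_singleton
  have hl1 : l 1 = 1 := hQ1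
  have h1 : (1 : L) ∈ U' := ⟨h.one_mem, by simp [hl1]⟩
  have su' := su.mono (inter_subset_left : U' ⊆ U)
  have sl' := sl.mono (inter_subset_left : U' ⊆ U)
  let f : L → E := fun g ↦ (l g)⁻¹ • u g
  have sf : ContMDiffOn 𝓘(ℝ, E) 𝓘(ℝ, E) ∞ f U' := (sl'.inv₀ fun g hg ↦ hg.2).smul su'
  have huf : EqOn u (fun g ↦ l g • f g) U' := fun g hg ↦ (smul_inv_smul₀ hg.2 (u g)).symm
  have dl : ∀ g ∈ U', MDifferentiableAt 𝓘(ℝ, E) 𝓘(ℝ, ℝ) l g := fun g hg ↦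
    mdifferentiableAt_of_contMDiffOn hU' hg sl'
  have df : ∀ g ∈ U', MDifferentiableAt 𝓘(ℝ, E) 𝓘(ℝ, E) f g := fun g hg ↦
    mdifferentiableAt_of_contMDiffOn hU' hg sf
  have hfirst : ∀ ξ : GroupLieAlgebra 𝓘(ℝ, E) L, ∀ g ∈ U',
      leftD ξ u g = l g • leftD ξ f g + leftD ξ l g • f g := fun ξ g hg ↦ by
    rw [leftD_congr_of_isOpen hU' hg huf, leftD_smul (dl g hg) (df g hg)]
  have hsec : ∀ g ∈ U', ∀ ξ η ζ : GroupLieAlgebra 𝓘(ℝ, E) L, ζ = B ξ η →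
      leftD ξ (leftD η f) g = leftD ζ f g + (-(l g)⁻¹ * leftD ξ l g) • leftD η f g +
        (-(l g)⁻¹ * leftD η l g) • leftD ξ f g := by
    intro g hg ξ η ζ hζ
    obtain ⟨c, hc⟩ := hsecF ξ η ζ hζ
    have hlg : l g ≠ 0 := hg.2
    have dl' := mdifferentiableAt_of_contMDiffOn hU' hg (contMDiffOn_leftD hU' sl' η)
    have df' := mdifferentiableAt_of_contMDiffOn hU' hg (contMDiffOn_leftD hU' sf η)
    have e1 : leftD ξ (leftD η l) g = leftD ζ l g + c * l g := by
      rw [leftD_congr_of_isOpen (v := fun x ↦ Q (leftD η F x)) h.isOpen hg.1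
        fun x hx ↦ hl x hx η, leftD_clm Q (dD η g hg.1), hc g hg.1, hl g hg.1]
      simp [l]
    have e2 : leftD ξ (leftD η u) g = leftD ζ u g + c • u g := by
      rw [leftD_congr_of_isOpen (v := fun x ↦ P (leftD η F x)) h.isOpen hg.1
        fun x hx ↦ hu x hx η, leftD_clm P (dD η g hg.1), hc g hg.1, hu g hg.1]
      simp [u]
    rw [leftD_congr_of_isOpen hU' hg (hfirst η),
      leftD_add (mdifferentiableAt_fun_smul (dl g hg) df')
        (mdifferentiableAt_fun_smul dl' (df g hg)),
      leftD_smul (dl g hg) df', leftD_smul dl' (df g hg), e1, hfirst ζ g hg, huf hg] at e2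
    have e3 : l g • leftD ξ (leftD η f) g = l g • leftD ζ f g - leftD ξ l g • leftD η f g -
        leftD η l g • leftD ξ f g := by
      have e4 := sub_eq_zero.2 e2
      rw [← sub_eq_zero, ← e4]
      dsimp only
      module
    have e5 : leftD ξ (leftD η f) g = (l g)⁻¹ • (l g • leftD ζ f g -
        leftD ξ l g • leftD η f g - leftD η l g • leftD ξ f g) := by
      rw [← e3, inv_smul_smul₀ hlg]
    rw [e5, smul_sub, smul_sub, inv_smul_smul₀ hlg]
    module
  have hinj : Function.Injective (mvfderiv 𝓘(ℝ, E) f 1) := by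
    have e1 : ∀ ξ : GroupLieAlgebra 𝓘(ℝ, E) L,
        mvfderiv 𝓘(ℝ, E) f 1 (leftTrivL E (1 : L) ξ) = ξ := by
      intro ξ
      have e2 := hfirst ξ 1 h1
      have e3 : f 1 = 0 := by simp only [f, u, hP1, smul_zero]
      rw [e3, smul_zero, add_zero, hl1, one_smul, hu 1 h.one_mem, hP] at e2
      exact e2.symm
    intro v w hvw
    obtain ⟨ξ, rfl⟩ := (leftTrivL E (1 : L)).surjective v
    obtain ⟨η, rfl⟩ := (leftTrivL E (1 : L)).surjective w
    rw [show ξ = η from (e1 ξ).symm.trans (hvw.trans (e1 η))]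
  obtain ⟨φ, hφ1, hφU, hφf, hφs, hφs'⟩ :=
    exists_openPartialHomeomorph_of_contMDiffOn hU' h1 sf hinj
  let b : E →L[ℝ] E →L[ℝ] E := 
    (show E →ₗ[ℝ] E →ₗ[ℝ] E from B).toContinuousBilinearMap
  refine ⟨invariantConn L b, isIFPS_invariantConn (b := b) hbr hφ1 hφs hφs'
    (θ := fun g ↦ LinearMap.toContinuousLinearMap
      (show E →ₗ[ℝ] ℝ from (-(l g)⁻¹) • leftDₗ (E := E) l g))
    (fun ξ ↦ ?_) fun g hg ξ η ζ hζ ↦ ?_⟩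
  · exact ((sl'.inv₀ fun g hg ↦ hg.2).neg.mul (contMDiffOn_leftD hU' sl' ξ)).mono hφU
  · have e1 : ∀ ζ : GroupLieAlgebra 𝓘(ℝ, E) L, EqOn (leftD ζ φ) (leftD ζ f) φ.source :=
      fun ζ x hx ↦ leftD_congr_of_isOpen φ.open_source hx hφf
    rw [leftD_congr_of_isOpen φ.open_source hg (e1 η), e1 _ hg, e1 _ hg, e1 _ hg]
    exact hsec g (hφU hg) ξ η ζ hζ

end LiftToConnection

/-! ### Lie algebras -/

section Conclusion

instance secondCountableTopology_units : SecondCountableTopology ℝˣ :=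
  Units.isEmbedding_val₀.secondCountableTopology

/-- The product of two isomorphisms of Lie algebras. -/
def lieEquivProdCongr {R 𝔤 𝔤' 𝔥 𝔥' : Type*} [CommRing R] [LieRing 𝔤] [LieAlgebra R 𝔤] [LieRing 𝔤']
    [LieAlgebra R 𝔤'] [LieRing 𝔥] [LieAlgebra R 𝔥] [LieRing 𝔥'] [LieAlgebra R 𝔥']
    (e : 𝔤 ≃ₗ⁅R⁆ 𝔤') (e' : 𝔥 ≃ₗ⁅R⁆ 𝔥') : (𝔤 × 𝔥) ≃ₗ⁅R⁆ 𝔤' × 𝔥' :=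
  { e.toLinearEquiv.prodCongr e'.toLinearEquiv with
    map_lie' := fun {x y} ↦ Prod.ext (e.map_lie x.1 y.1) (e'.map_lie x.2 y.2) }

/-- A Lie algebra which admits a left-invariant flat projective structure belongs to a Lie group
with a homogeneous lift. The group may have to be changed: on a one-dimensional group every
torsion-free connection is projectively flat, so there the structure carries no information, and
the group `ℝˣ` is used. -/
theorem AdmitsIFPS.exists_hasHomogeneousLift {𝔩 : Type*} [LieRing 𝔩] [LieAlgebra ℝ 𝔩]
    (h : AdmitsIFPS 𝔩) :
    ∃ (E : Type) (_ : NormedAddCommGroup E) (_ : NormedSpace ℝ E) (_ : FiniteDimensional ℝ E)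
      (L : Type) (_ : TopologicalSpace L) (_ : T2Space L) (_ : SecondCountableTopology L)
      (_ : ChartedSpace E L) (_ : Group L) (_ : LieGroup 𝓘(ℝ, E) ∞ L),
      Nonempty (𝔩 ≃ₗ⁅ℝ⁆ GroupLieAlgebra 𝓘(ℝ, E) L) ∧ HasHomogeneousLift E L := by
  obtain ⟨E, _, _, _, L, _, _, _, _, _, _, ⟨e⟩, hL⟩ := h
  rcases Nat.lt_or_ge (Module.finrank ℝ E) 2 with hn | hn
  · interval_cases hd : Module.finrank ℝ E
    · exact ⟨E, inferInstance, inferInstance, inferInstance, L, inferInstance, inferInstance,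
        inferInstance, inferInstance, inferInstance, inferInstance, ⟨e⟩,
        ℝ, inferInstance, inferInstance, inferInstance, univ, _, isHomogeneousLift_const hd⟩
    · have h1 : Module.finrank ℝ 𝔩 = 1 := by
        rw [e.toLinearEquiv.finrank_eq, finrank_groupLieAlgebra, hd]
      have h2 : Module.finrank ℝ (GroupLieAlgebra 𝓘(ℝ, ℝ) ℝˣ) = 1 := by
        rw [finrank_groupLieAlgebra, Module.finrank_self]
      exact ⟨ℝ, inferInstance, inferInstance, inferInstance, ℝˣ, inferInstance, inferInstance,
        inferInstance, inferInstance, inferInstance, inferInstance,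
        nonempty_lieEquiv_of_finrank_eq_one h1 h2,
        ℝ × ℝ, inferInstance, inferInstance, inferInstance, univ, _, isHomogeneousLift_units⟩
  · exact ⟨E, inferInstance, inferInstance, inferInstance, L, inferInstance, inferInstance,
        inferInstance, inferInstance, inferInstance, inferInstance, ⟨e⟩,
        hL.hasHomogeneousLift hn⟩

attribute [local instance] chartedSpaceProd lieGroup_prod

theorem AdmitsIFPS.prod {𝔩₁ : Type*} [LieRing 𝔩₁] [LieAlgebra ℝ 𝔩₁]
    {𝔩₂ : Type*} [LieRing 𝔩₂] [LieAlgebra ℝ 𝔩₂] {𝔞₁ : Type*} [LieRing 𝔞₁] [LieAlgebra ℝ 𝔞₁]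
    (h𝔞₁ : Module.finrank ℝ 𝔞₁ = 1) (h₁ : AdmitsIFPS 𝔩₁) (h₂ : AdmitsIFPS 𝔩₂) :
    AdmitsIFPS (𝔩₁ × 𝔩₂ × 𝔞₁) := by
  obtain ⟨E₁, _, _, _, L₁, _, _, _, _, _, _, ⟨e₁⟩, H₁⟩ := h₁.exists_hasHomogeneousLift
  obtain ⟨E₂, _, _, _, L₂, _, _, _, _, _, _, ⟨e₂⟩, H₂⟩ := h₂.exists_hasHomogeneousLift
  obtain ⟨e₃⟩ := nonempty_lieEquiv_of_finrank_eq_one h𝔞₁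
    (𝔩' := GroupLieAlgebra 𝓘(ℝ, ℝ) ℝˣ) (by rw [finrank_groupLieAlgebra, Module.finrank_self])
  obtain ⟨V, _, _, _, U, F, hF⟩ := H₁.prod_units H₂
  refine ⟨E₁ × E₂ × ℝ, inferInstance, inferInstance, inferInstance, L₁ × L₂ × ℝˣ, inferInstance,
    inferInstance, inferInstance, inferInstance, inferInstance, inferInstance, ?_,
    hF.lieGroupAdmitsIFPS⟩
  exact ⟨(lieEquivProdCongr e₁ (lieEquivProdCongr e₂ e₃)).trans
    (groupLieAlgebraProdEquiv.trans
      (lieEquivProdCongr LieEquiv.refl groupLieAlgebraProdEquiv)).symm⟩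

end Conclusion

end ProjectiveStructure

end

theorem proposition3p4
    {𝔩₁ : Type*} [LieRing 𝔩₁] [LieAlgebra ℝ 𝔩₁]
    {𝔩₂ : Type*} [LieRing 𝔩₂] [LieAlgebra ℝ 𝔩₂]
    {𝔞₁ : Type*} [LieRing 𝔞₁] [LieAlgebra ℝ 𝔞₁] [IsLieAbelian 𝔞₁]
    (h𝔞₁ : Module.finrank ℝ 𝔞₁ = 1)
    (h₁ : ProjectiveStructure.AdmitsIFPS 𝔩₁) (h₂ : ProjectiveStructure.AdmitsIFPS 𝔩₂) :
    ProjectiveStructure.AdmitsIFPS (𝔩₁ × 𝔩₂ × 𝔞₁) :=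
  ProjectiveStructure.AdmitsIFPS.prod h𝔞₁ h₁ h₂
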